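/- Let $k$ be a totally real number field and $A$ a division quaternion algebra with centre $k$ such that $A\otimes_{k,\phi}\mathbb{R}\cong M_2(\mathbb{R})$ for exactly two embeddings $\phi=\phi_1,\phi_2$ of $k$ into $\mathbb{R}$, and $A\otimes_{k,\phi}\mathbb{R}$ is a division algebra for every other embedding $\phi:k\to\mathbb{R}$. Let $A^+\subset A^\times$ be the group of units of totally positive reduced norm; through isomorphisms $A\otimes_{k,\phi_i}\mathbb{R}\cong M_2(\mathbb{R})$ ($i=1,2$) the group $A^+/k^\times$ acts on $\mathbb{H}\times\mathbb{H}$ by Möbius transformations in each factor, where $\mathbb{H}$ is the complex upper half plane. Let $\Gamma\subset A^+/k^\times$ be a torsion-free subgroup commensurable with $\mathcal{O}^1/\{\pm1\}$, where $\mathcal{O}^1$ is the group of units of reduced norm $1$ of a maximal order $\mathcal{O}$ of $A$, and let $X=\Gamma\backslash(\mathbb{H}\times\mathbb{H})$ be the corresponding smooth quaternionic Shimura surface. Theorem. Let $\sigma$ be an automorphism of $X$, $\sigma\neq\mathrm{id}_X$. Then either $\sigma$ has only finitely many fixed points, or the fixed point set of $\sigma$ is a (nonempty, infinite) divisor, i.e.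 a closed analytic subset of $X$ of pure dimension one, and $\sigma^2=1$. In the second case $\sigma$ lifts to a conjugate of the involution $\mu(z_1,z_2)=(z_2,z_1)$: there is a biholomorphic map $f$ of $\mathbb{H}\times\mathbb{H}$ onto itself such that $f\mu f^{-1}$ induces $\sigma$ on $X$. -/

import Mathlib

open scoped TensorProduct Manifold MatrixGroups UpperHalfPlane

noncomputable section

namespace Shimura

/-! ### Quaternion algebras over a totally real field -/

section Algebra

variable (k : Type*) [Field k] (A : Type*) [DivisionRing A] [Algebra k A]

/-- The reduced characteristic polynomial of an element of a quaternion division algebra: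
the minimal polynomial of an element outside of the centre, and `(X - x) ^ 2` for a central `x`. -/
def reducedCharpoly {A : Type*} [DivisionRing A] [Algebra k A] (a : A) : Polynomial k :=
  minpoly k a ^ (2 / (minpoly k a).natDegree)

/-- The reduced norm of an element of a quaternion division algebra. -/
def reducedNorm {A : Type*} [DivisionRing A] [Algebra k A] (a : A) : k :=
  (reducedCharpoly k a).coeff 0

section Splitting

variable {k A}
variable [Algebra k ℝ] (e : (ℝ ⊗[k] A) ≃ₐ[ℝ] Matrix (Fin 2) (Fin 2) ℝ)

/-- The representation `A → M₂(ℝ)` given by an isomorphism of `ℝ ⊗ A` with `M₂(ℝ)`. -/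
def splitHom : A →+* Matrix (Fin 2) (Fin 2) ℝ :=
  (e : (ℝ ⊗[k] A) →+* Matrix (Fin 2) (Fin 2) ℝ).comp
    (Algebra.TensorProduct.includeRight : A →ₐ[k] ℝ ⊗[k] A).toRingHom

lemma splitHom_apply (a : A) : splitHom e a = e (1 ⊗ₜ[k] a) := rfl

lemma splitHom_algebraMap (x : k) :
    splitHom e (algebraMap k A x) = algebraMap ℝ _ (algebraMap k ℝ x) := by
  have h : (1 : ℝ) ⊗ₜ[k] (algebraMap k A x) = algebraMap ℝ (ℝ ⊗[k] A) (algebraMap k ℝ x) := by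
    rw [Algebra.TensorProduct.algebraMap_apply, Algebra.algebraMap_eq_smul_one,
      TensorProduct.tmul_smul, TensorProduct.smul_tmul', Algebra.smul_def, mul_one]
    rfl
  rw [splitHom_apply, h, AlgEquiv.commutes]

lemma linearIndependent_splitHom {ι : Type*} {v : ι → A} (hv : LinearIndependent k v) :
    LinearIndependent ℝ (fun i => splitHom e (v i)) := by
  have h : LinearIndependent ℝ (fun i => ((1 : ℝ) ⊗ₜ[k] v i)) :=
    Module.Flat.linearIndependent_one_tmul hv
  exact h.map' e.toLinearMap (LinearMap.ker_eq_bot.2 e.injective)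

lemma splitHom_aeval (a : A) (p : Polynomial k) :
    splitHom e (Polynomial.aeval a p) =
      Polynomial.aeval (splitHom e a) (p.map (algebraMap k ℝ)) := by
  rw [Polynomial.aeval_def, Polynomial.hom_eval₂, Polynomial.aeval_def, Polynomial.eval₂_map]
  congr 1
  ext1 x
  exact splitHom_algebraMap e x

/-- The reduced norm is the determinant in a splitting. -/
lemma algebraMap_reducedNorm (a : A) :
    algebraMap k ℝ (reducedNorm k a) = (splitHom e a).det := by
  by_cases ha : a ∈ (algebraMap k A).range
  · obtain ⟨x, rfl⟩ := ha
    rw [reducedNorm, reducedCharpoly, minpoly.eq_X_sub_C, splitHom_algebraMap]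
    simp [Algebra.algebraMap_eq_smul_one, pow_two, Polynomial.mul_coeff_zero]
  · set M := splitHom e a with hM
    have hdep : ¬ LinearIndependent k ![1, a, a ^ 2] := by
      intro h
      have h3 := linearIndependent_splitHom e h
      have := Matrix.aeval_self_charpoly M
      rw [Matrix.charpoly_fin_two] at this
      rw [Fintype.linearIndependent_iff] at h3
      have := h3 ![M.det, -M.trace, 1] (by
        simp only [Fin.sum_univ_three]
        simp only [map_add, map_sub, map_mul, map_pow, Polynomial.aeval_X, Polynomial.aeval_C]
          at this
        simp [Algebra.algebraMap_eq_smul_one, map_pow, ← hM] at this ⊢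
        rw [← this]; abel) 2
      simp at this
    have hlin : LinearIndependent k ![1, a] := by
      rw [LinearIndependent.pair_iff]
      intro s t hst
      have ht : t = 0 := by
        by_contra ht
        refine ha ⟨-(t⁻¹ * s), ?_⟩
        have : t⁻¹ • (s • (1 : A) + t • a) = 0 := by rw [hst, smul_zero]
        rw [smul_add, smul_smul, smul_smul, inv_mul_cancel₀ ht, one_smul] at this
        rw [map_neg, Algebra.algebraMap_eq_smul_one]
        exact (eq_neg_of_add_eq_zero_right this).symm
      subst ht
      simpa using hst
    have hlinM := linearIndependent_splitHom e hlin
    obtain ⟨p, hp0, hpd, hpa⟩ : ∃ p : Polynomial k, p ≠ 0 ∧ p.natDegree ≤ 2 ∧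
        Polynomial.aeval a p = 0 := by
      rw [Fintype.not_linearIndependent_iff] at hdep
      obtain ⟨g, hg, i, hi⟩ := hdep
      refine ⟨Polynomial.C (g 2) * Polynomial.X ^ 2 + Polynomial.C (g 1) * Polynomial.X +
        Polynomial.C (g 0), ?_, Polynomial.natDegree_quadratic_le, ?_⟩
      · intro h
        have h0 := congrArg (fun q => Polynomial.coeff q 0) h
        have h1 := congrArg (fun q => Polynomial.coeff q 1) h
        have h2 := congrArg (fun q => Polynomial.coeff q 2) h
        simp [Polynomial.coeff_X, Polynomial.coeff_C] at h0 h1 h2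
        fin_cases i <;> simp_all
      · rw [Fin.sum_univ_three] at hg
        simp only [map_add, map_mul, map_pow, Polynomial.aeval_X, Polynomial.aeval_C]
        simp only [Algebra.algebraMap_eq_smul_one]
        rw [← hg]
        simp
        abel
    have hint : IsIntegral k a := IsAlgebraic.isIntegral ⟨p, hp0, hpa⟩
    have hdeg : (minpoly k a).natDegree = 2 := by
      have h1 : (minpoly k a).natDegree ≤ 2 :=
        (Polynomial.natDegree_le_natDegree (minpoly.degree_le_of_ne_zero k a hp0 hpa)).trans hpd
      have h2 := minpoly.natDegree_pos hint
      have h3 : (minpoly k a).natDegree ≠ 1 := fun h => ha (minpoly.natDegree_eq_one_iff.1 h)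
      omega
    have hpoly : (minpoly k a).map (algebraMap k ℝ) = M.charpoly := by
      have hq : Polynomial.aeval M ((minpoly k a).map (algebraMap k ℝ) - M.charpoly) = 0 := by
        rw [map_sub, Matrix.aeval_self_charpoly, ← splitHom_aeval, minpoly.aeval, map_zero,
          sub_zero]
      have hmon := (minpoly.monic hint).map (algebraMap k ℝ)
      have hmd : ((minpoly k a).map (algebraMap k ℝ)).natDegree = 2 := by
        rw [Polynomial.natDegree_map, hdeg]
      have hcd : M.charpoly.natDegree = 2 := by
        rw [Matrix.charpoly_natDegree_eq_dim, Fintype.card_fin]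
      have hlt : ((minpoly k a).map (algebraMap k ℝ) - M.charpoly).degree < 2 := by
        have := Polynomial.degree_sub_lt_left (p := (minpoly k a).map (algebraMap k ℝ))
          (q := M.charpoly) (by
            rw [Polynomial.degree_eq_natDegree hmon.ne_zero, hmd,
              Polynomial.degree_eq_natDegree (Matrix.charpoly_monic M).ne_zero, hcd])
          hmon.ne_zero (by rw [hmon.leadingCoeff, (Matrix.charpoly_monic M).leadingCoeff])
        rwa [Polynomial.degree_eq_natDegree hmon.ne_zero, hmd] at this
      set r := (minpoly k a).map (algebraMap k ℝ) - M.charpoly with hr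
      have hr1 : r = Polynomial.C (r.coeff 1) * Polynomial.X + Polynomial.C (r.coeff 0) :=
        Polynomial.eq_X_add_C_of_degree_le_one (by
          rcases eq_or_ne r 0 with h | h
          · simp [h]
          · rw [Polynomial.degree_eq_natDegree h] at hlt ⊢
            norm_cast at hlt ⊢
            omega)
      rw [hr1] at hq
      simp only [map_add, map_mul, Polynomial.aeval_X, Polynomial.aeval_C] at hq
      rw [Fintype.linearIndependent_iff] at hlinM
      have hz := hlinM ![r.coeff 0, r.coeff 1] (by
        rw [Fin.sum_univ_two, ← hq, Algebra.algebraMap_eq_smul_one (r.coeff 0),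
          ← Algebra.smul_def, add_comm]
        simp [hM])
      have hz0 : r.coeff 0 = 0 := hz 0
      have hz1 : r.coeff 1 = 0 := hz 1
      rw [hz0, hz1] at hr1
      have : r = 0 := by rw [hr1]; simp
      exact sub_eq_zero.1 this
    rw [reducedNorm, reducedCharpoly, hdeg, ← Polynomial.coeff_map]
    simp [hpoly, Matrix.charpoly_fin_two]

lemma reducedNorm_mul (e : (ℝ ⊗[k] A) ≃ₐ[ℝ] Matrix (Fin 2) (Fin 2) ℝ) (a b : A) :
    reducedNorm k (a * b) = reducedNorm k a * reducedNorm k b := by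
  apply (algebraMap k ℝ).injective
  rw [map_mul, algebraMap_reducedNorm e, algebraMap_reducedNorm e, algebraMap_reducedNorm e,
    map_mul, Matrix.det_mul]

lemma reducedNorm_one (e : (ℝ ⊗[k] A) ≃ₐ[ℝ] Matrix (Fin 2) (Fin 2) ℝ) :
    reducedNorm k (1 : A) = 1 := by
  apply (algebraMap k ℝ).injective
  rw [map_one, algebraMap_reducedNorm e, map_one, Matrix.det_one]

end Splitting

/-- `A` is unramified at exactly two real places `place₁` and `place₂`: there `ℝ ⊗ A`, with `k`
acting on `ℝ` through the place, is identified with `M₂(ℝ)`, and at every other real place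
`ℝ ⊗ A` is a division algebra. -/
structure TwoPlaceSplitting where
  place₁ : k →+* ℝ
  place₂ : k →+* ℝ
  place_ne : place₁ ≠ place₂
  split₁ : letI := place₁.toAlgebra; (ℝ ⊗[k] A) ≃ₐ[ℝ] Matrix (Fin 2) (Fin 2) ℝ
  split₂ : letI := place₂.toAlgebra; (ℝ ⊗[k] A) ≃ₐ[ℝ] Matrix (Fin 2) (Fin 2) ℝ
  ramified : ∀ φ : k →+* ℝ, φ ≠ place₁ → φ ≠ place₂ →
    letI := φ.toAlgebra; ∀ x : ℝ ⊗[k] A, x ≠ 0 → IsUnit x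

variable {A} in
/-- `O` is an order of `A`: a subring containing the integers of `k` that is a full lattice. -/
def IsOrder (O : Subring A) : Prop :=
  (∀ x : NumberField.RingOfIntegers k, algebraMap k A (x : k) ∈ O) ∧
    O.toAddSubgroup.FG ∧ Submodule.span k (O : Set A) = ⊤

variable {A} in
/-- `O` is a maximal order of `A`. -/
def IsMaximalOrder (O : Subring A) : Prop :=
  IsOrder k O ∧ ∀ O' : Subring A, IsOrder k O' → O ≤ O' → O' = O

/-- The image of `kˣ` in `Aˣ`. -/
def scalarUnits : Subgroup Aˣ :=
  (Units.map (algebraMap k A).toMonoidHom).range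

instance : (scalarUnits k A).Normal where
  conj_mem := by
    rintro _ ⟨x, rfl⟩ u
    refine ⟨x, ?_⟩
    rw [eq_mul_inv_iff_mul_eq]
    ext
    exact Algebra.commutes (x : k) (u : A)

/-- The group `Aˣ / kˣ`. -/
abbrev ProjUnits : Type _ := Aˣ ⧸ scalarUnits k A

variable {k A}

namespace TwoPlaceSplitting

variable (D : TwoPlaceSplitting k A)

/-- The representation `ρ₁ : A → M₂(ℝ)`. -/
def rep₁ : A →+* Matrix (Fin 2) (Fin 2) ℝ :=
  letI := D.place₁.toAlgebra
  splitHom D.split₁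

/-- The representation `ρ₂ : A → M₂(ℝ)`. -/
def rep₂ : A →+* Matrix (Fin 2) (Fin 2) ℝ :=
  letI := D.place₂.toAlgebra
  splitHom D.split₂

lemma rep₁_algebraMap (x : k) : D.rep₁ (algebraMap k A x) = algebraMap ℝ _ (D.place₁ x) :=
  letI := D.place₁.toAlgebra
  splitHom_algebraMap D.split₁ x

lemma rep₂_algebraMap (x : k) : D.rep₂ (algebraMap k A x) = algebraMap ℝ _ (D.place₂ x) :=
  letI := D.place₂.toAlgebra
  splitHom_algebraMap D.split₂ x

lemma nrd_mul (D : TwoPlaceSplitting k A) (a b : A) : reducedNorm k (a * b) = reducedNorm k a * reducedNorm k b :=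
  letI := D.place₁.toAlgebra
  reducedNorm_mul D.split₁ a b

lemma nrd_one (D : TwoPlaceSplitting k A) : reducedNorm k (1 : A) = 1 :=
  letI := D.place₁.toAlgebra
  reducedNorm_one D.split₁

lemma nrd_inv (D : TwoPlaceSplitting k A) (u : Aˣ) :
    reducedNorm k ((u⁻¹ : Aˣ) : A) = (reducedNorm k (u : A))⁻¹ := by
  apply eq_inv_of_mul_eq_one_left
  rw [← D.nrd_mul, Units.inv_mul, D.nrd_one]

/-- The group `A⁺` of units of totally positive reduced norm. -/
def positiveUnits : Subgroup Aˣ where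
  carrier := {u | ∀ φ : k →+* ℝ, 0 < φ (reducedNorm k (u : A))}
  one_mem' φ := by simp [D.nrd_one]
  mul_mem' {a b} ha hb φ := by
    rw [Units.val_mul, D.nrd_mul, map_mul]
    exact mul_pos (ha φ) (hb φ)
  inv_mem' {a} ha φ := by
    rw [D.nrd_inv, map_inv₀]
    exact inv_pos.2 (ha φ)

/-- The group of units of reduced norm `1` of the ring `O`. -/
def normOneUnits (O : Subring A) : Subgroup Aˣ where
  carrier := {u | (u : A) ∈ O ∧ ((u⁻¹ : Aˣ) : A) ∈ O ∧ reducedNorm k (u : A) = 1}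
  one_mem' := by simp [D.nrd_one, O.one_mem]
  mul_mem' {a b} ha hb := by
    refine ⟨?_, ?_, ?_⟩
    · exact O.mul_mem ha.1 hb.1
    · rw [mul_inv_rev]
      exact O.mul_mem hb.2.1 ha.2.1
    · rw [Units.val_mul, D.nrd_mul, ha.2.2, hb.2.2, mul_one]
  inv_mem' {a} ha := by
    refine ⟨ha.2.1, ?_, ?_⟩
    · rw [inv_inv]
      exact ha.1
    · rw [D.nrd_inv, ha.2.2, inv_one]

/-- The action of `Aˣ` on `ℍ × ℍ` by Möbius transformations through `(ρ₁, ρ₂)`. -/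
def unitsAct : Aˣ →* Equiv.Perm (ℍ × ℍ) where
  toFun u := Equiv.prodCongr
    (MulAction.toPerm (Units.map D.rep₁.toMonoidHom u : GL (Fin 2) ℝ))
    (MulAction.toPerm (Units.map D.rep₂.toMonoidHom u : GL (Fin 2) ℝ))
  map_one' := by ext p <;> simp
  map_mul' u v := by ext p <;> simp [mul_smul]

lemma unitsAct_scalar (u : Aˣ) (hu : u ∈ scalarUnits k A) : D.unitsAct u = 1 := by
  obtain ⟨x, rfl⟩ := hu
  have h₁ : Units.map D.rep₁.toMonoidHom (Units.map (algebraMap k A).toMonoidHom x) =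
      Matrix.GeneralLinearGroup.scalar (Fin 2) (Units.map D.place₁.toMonoidHom x) := by
    ext1
    exact D.rep₁_algebraMap x
  have h₂ : Units.map D.rep₂.toMonoidHom (Units.map (algebraMap k A).toMonoidHom x) =
      Matrix.GeneralLinearGroup.scalar (Fin 2) (Units.map D.place₂.toMonoidHom x) := by
    ext1
    exact D.rep₂_algebraMap x
  apply Equiv.ext
  rintro ⟨z, w⟩
  change ((Units.map D.rep₁.toMonoidHom _ : GL (Fin 2) ℝ) • z,
    (Units.map D.rep₂.toMonoidHom _ : GL (Fin 2) ℝ) • w) = (z, w)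
  rw [h₁, h₂]
  exact Prod.ext (UpperHalfPlane.glScalar_smul _ z) (UpperHalfPlane.glScalar_smul _ w)

/-- The action of `Aˣ / kˣ` on `ℍ × ℍ`. -/
def act : ProjUnits k A →* Equiv.Perm (ℍ × ℍ) :=
  QuotientGroup.lift (scalarUnits k A) D.unitsAct D.unitsAct_scalar

/-- The groups that define smooth quaternionic Shimura surfaces: torsion-free subgroups of
`A⁺ / kˣ` commensurable with the group `O¹ / {±1}` of a maximal order `O`. -/
structure IsSmoothShimuraGroup (Γ : Subgroup (ProjUnits k A)) : Prop where
  le_positive : Γ ≤ D.positiveUnits.map (QuotientGroup.mk' (scalarUnits k A))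
  commensurable : ∃ O : Subring A, IsMaximalOrder k O ∧
    Γ.Commensurable ((D.normOneUnits O).map (QuotientGroup.mk' (scalarUnits k A)))
  torsionFree : ∀ γ ∈ Γ, IsOfFinOrder γ → γ = 1

/-- The surface `X_Γ = Γ \ (ℍ × ℍ)`, with the quotient topology. -/
abbrev Surface (Γ : Subgroup (ProjUnits k A)) : Type :=
  MulAction.orbitRel.Quotient (Γ.map D.act) (ℍ × ℍ)

/-- The quotient map `ℍ × ℍ → X_Γ`. -/
def proj (Γ : Subgroup (ProjUnits k A)) (p : ℍ × ℍ) : D.Surface Γ :=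
  Quotient.mk _ p

end TwoPlaceSplitting

end Algebra

/-! ### Holomorphic functions and maps -/

/-- Biholomorphic self-maps of `ℍ × ℍ`. -/
def IsBiholomorphicBidisc (f : (ℍ × ℍ) ≃ₜ (ℍ × ℍ)) : Prop :=
  MDifferentiable (𝓘(ℂ).prod 𝓘(ℂ)) (𝓘(ℂ).prod 𝓘(ℂ)) f ∧
    MDifferentiable (𝓘(ℂ).prod 𝓘(ℂ)) (𝓘(ℂ).prod 𝓘(ℂ)) f.symm

section Surface

variable {k : Type*} [Field k] {A : Type*} [DivisionRing A] [Algebra k A]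
  {D : TwoPlaceSplitting k A} {Γ : Subgroup (ProjUnits k A)}

/-- The complex structure of `X_Γ`: a function on an open set `U` is holomorphic if its pullback
to `ℍ × ℍ` is. -/
def IsHolomorphicOn (U : Set (D.Surface Γ)) (g : D.Surface Γ → ℂ) : Prop :=
  MDifferentiableOn (𝓘(ℂ).prod 𝓘(ℂ)) 𝓘(ℂ) (g ∘ D.proj Γ) (D.proj Γ ⁻¹' U)

/-- A continuous self-map of `X_Γ` is holomorphic if it pulls back holomorphic functions on open
sets to holomorphic functions. -/
def IsHolomorphicMap (f : D.Surface Γ → D.Surface Γ) : Prop :=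
  Continuous f ∧ ∀ (U : Set (D.Surface Γ)) (g : D.Surface Γ → ℂ),
    IsOpen U → IsHolomorphicOn U g → IsHolomorphicOn (f ⁻¹' U) (g ∘ f)

/-- `f` is an automorphism of the complex surface `X_Γ`. -/
def IsAutomorphism (f : D.Surface Γ ≃ₜ D.Surface Γ) : Prop :=
  IsHolomorphicMap f ∧ IsHolomorphicMap f.symm

/-- `C` is (the support of) a nonzero effective divisor: it is nonempty, and near each point of
the surface it is the zero set of a holomorphic function that does not vanish identically on any
nonempty open set. -/
def IsDivisor (C : Set (D.Surface Γ)) : Prop :=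
  C.Nonempty ∧ ∀ x : D.Surface Γ, ∃ (U : Set (D.Surface Γ)) (g : D.Surface Γ → ℂ),
    IsOpen U ∧ x ∈ U ∧ IsHolomorphicOn U g ∧
    (∀ V ⊆ U, IsOpen V → V.Nonempty → ∃ y ∈ V, g y ≠ 0) ∧
    C ∩ U = {y ∈ U | g y = 0}

/-- `σ` lifts to a conjugate of the involution of `ℍ × ℍ` that exchanges the factors, the
conjugation being by an automorphism of `ℍ × ℍ`. -/
def LiftsToConjugateOfSwap (σ : D.Surface Γ ≃ₜ D.Surface Γ) : Prop :=
  ∃ f : (ℍ × ℍ) ≃ₜ (ℍ × ℍ), IsBiholomorphicBidisc f ∧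
    ∀ p : ℍ × ℍ, D.proj Γ (f (f.symm p).swap) = σ (D.proj Γ p)

end Surface

end Shimura

end

open scoped TensorProduct Manifold MatrixGroups UpperHalfPlane

noncomputable section

/-! Suppose that $\sigma$ has infinitely many fixed points. Since $X$ is compact and Hausdorff they
accumulate at a fixed point. Lift $\sigma$ to a homeomorphism $f$ of $\mathbb{H}\times\mathbb{H}$
fixing a point $p$ above it. The projection is injective near $p$, so nearby fixed points of
$\sigma$ come from fixed points of $f$, and $f$ has a second fixed point $y\neq p$. The lift is
biholomorphic, so by the Schwarz lemma for the bidisc (`monomial_of_bidisc_automorphism`) it is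
$(z,w)\mapsto(az,bw)$ or $(z,w)\mapsto(aw,bz)$ in Cayley coordinates centred at $p$.

In the first case $y$ forces $a=1$ or $b=1$, say $a=1$. For $\gamma\in\Gamma$ the conjugate $f\gamma
f^{-1}$ lies in $\Gamma$ and agrees with $\gamma$ on the first factor, where $\Gamma$ acts
faithfully; hence $f$ commutes with $\Gamma$ and fixes the orbit $\Gamma p$. If $b\neq1$, the second
coordinate of every fixed point is $p_2$, so $\Gamma$ fixes $p_2$; the distance to $p_2$ is then
$\Gamma$-invariant and unbounded, against cocompactness. So $f$ and $\sigma$ are trivial.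

In the second case $y$ forces $ab=1$, so $f^2=1$ and $f(z,w)=(u(w),u^{-1}(z))$. This is conjugate to
the exchange of the factors by $u\times\mathrm{id}$, and its fixed points are given by the single
equation $z=u(w)$, whence the divisor.

The argument needs $\Gamma$ to act freely, properly discontinuously and cocompactly. By
commensurability the last two reduce to $\mathcal{O}^1$. Discontinuity
(`finite_normOneUnits_bounded`) holds because bounded entries at the two split places bound all
conjugates of the integral numbers $\mathrm{tr}(ub_i)$, for a basis $(b_i)$ in $\mathcal{O}$.
Cocompactness (`cocompact_normOne`) follows from Minkowski's theorem: every unimodular translate of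
$\mathcal{O}$ has a bounded nonzero element, its norm is nonzero and takes finitely many values, and
elements of a given norm form finitely many classes modulo $\mathcal{O}^1$. Freeness follows from
finite stabilizers and torsion-freeness. -/

namespace Shimura

/-! ### Reduced trace and the quadratic equation of an element -/

section Trace

variable {k : Type*} [Field k] {A : Type*} [DivisionRing A] [Algebra k A]

variable (k) in
/-- The reduced trace, as the polarization of the reduced norm at `1`. -/
def reducedTrace (a : A) : k := reducedNorm k (a + 1) - reducedNorm k a - 1

section Splitting

variable [Algebra k ℝ] (e : (ℝ ⊗[k] A) ≃ₐ[ℝ] Matrix (Fin 2) (Fin 2) ℝ)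

lemma algebraMap_reducedTrace (a : A) :
    algebraMap k ℝ (reducedTrace k a) = (splitHom e a).trace := by
  simp only [reducedTrace, map_sub, map_one, algebraMap_reducedNorm e, map_add,
    Matrix.det_fin_two, Matrix.trace_fin_two]
  simp
  ring

end Splitting

namespace TwoPlaceSplitting

variable (D : TwoPlaceSplitting k A)

lemma place₁_reducedNorm (a : A) : D.place₁ (reducedNorm k a) = (D.rep₁ a).det :=
  letI := D.place₁.toAlgebra
  algebraMap_reducedNorm D.split₁ a

lemma place₂_reducedNorm (a : A) : D.place₂ (reducedNorm k a) = (D.rep₂ a).det :=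
  letI := D.place₂.toAlgebra
  algebraMap_reducedNorm D.split₂ a

lemma place₁_reducedTrace (a : A) : D.place₁ (reducedTrace k a) = (D.rep₁ a).trace :=
  letI := D.place₁.toAlgebra
  algebraMap_reducedTrace D.split₁ a

lemma place₂_reducedTrace (a : A) : D.place₂ (reducedTrace k a) = (D.rep₂ a).trace :=
  letI := D.place₂.toAlgebra
  algebraMap_reducedTrace D.split₂ a

lemma linearIndependent_rep₁ {ι : Type*} {v : ι → A} (hv : LinearIndependent k v) :
    LinearIndependent ℝ (fun i => D.rep₁ (v i)) :=
  letI := D.place₁.toAlgebra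
  linearIndependent_splitHom D.split₁ hv

lemma linearIndependent_rep₂ {ι : Type*} {v : ι → A} (hv : LinearIndependent k v) :
    LinearIndependent ℝ (fun i => D.rep₂ (v i)) :=
  letI := D.place₂.toAlgebra
  linearIndependent_splitHom D.split₂ hv

lemma rep₁_smul (x : k) (a : A) : D.rep₁ (x • a) = D.place₁ x • D.rep₁ a := by
  rw [Algebra.smul_def, map_mul, D.rep₁_algebraMap, ← Algebra.smul_def]

lemma rep₂_smul (x : k) (a : A) : D.rep₂ (x • a) = D.place₂ x • D.rep₂ a := by
  rw [Algebra.smul_def, map_mul, D.rep₂_algebraMap, ← Algebra.smul_def]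

/-- The reduced trace as a linear form. -/
def traceForm : A →ₗ[k] k where
  toFun := reducedTrace k
  map_add' a b := D.place₁.injective (by simp [place₁_reducedTrace])
  map_smul' x a := D.place₁.injective (by simp [place₁_reducedTrace, rep₁_smul])

lemma traceForm_apply (a : A) : D.traceForm a = reducedTrace k a := rfl

lemma reducedTrace_algebraMap (D : TwoPlaceSplitting k A) (x : k) :
    reducedTrace k (algebraMap k A x) = 2 * x := by
  apply D.place₁.injective
  rw [place₁_reducedTrace, rep₁_algebraMap, Matrix.trace_fin_two, map_mul, map_ofNat]
  simp [Matrix.algebraMap_matrix_apply]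
  ring

lemma reducedNorm_algebraMap (D : TwoPlaceSplitting k A) (x : k) :
    reducedNorm k (algebraMap k A x) = x ^ 2 := by
  apply D.place₁.injective
  rw [place₁_reducedNorm, rep₁_algebraMap, Matrix.det_fin_two]
  simp [Matrix.algebraMap_matrix_apply]
  ring

lemma mul_self_eq (D : TwoPlaceSplitting k A) (a : A) :
    a * a = reducedTrace k a • a - algebraMap k A (reducedNorm k a) := by
  apply D.rep₁.injective
  rw [map_mul, map_sub, rep₁_smul, rep₁_algebraMap, place₁_reducedNorm, place₁_reducedTrace]
  ext i j
  fin_cases i <;> fin_cases j <;>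
    simp [Matrix.mul_apply, Matrix.det_fin_two, Matrix.trace_fin_two,
      Matrix.algebraMap_matrix_apply] <;> ring

lemma mul_conj (D : TwoPlaceSplitting k A) (a : A) :
    a * (algebraMap k A (reducedTrace k a) - a) = algebraMap k A (reducedNorm k a) := by
  rw [mul_sub, D.mul_self_eq, ← Algebra.commutes, ← Algebra.smul_def]
  abel

lemma conj_mul (D : TwoPlaceSplitting k A) (a : A) :
    (algebraMap k A (reducedTrace k a) - a) * a = algebraMap k A (reducedNorm k a) := by
  rw [sub_mul, D.mul_self_eq, ← Algebra.smul_def]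
  abel

lemma reducedNorm_ne_zero (D : TwoPlaceSplitting k A) {a : A} (ha : a ≠ 0) :
    reducedNorm k a ≠ 0 := by
  intro h
  have h1 := D.nrd_mul a a⁻¹
  rw [mul_inv_cancel₀ ha, D.nrd_one, h, zero_mul] at h1
  exact one_ne_zero h1

/-- Polarization of $2\,\mathrm{nrd}(a)=\mathrm{tr}(a)^2-\mathrm{tr}(a^2)$. It bounds the norm
through coordinates at the ramified places, where it is not available as a determinant of real
$2\times2$ matrices. -/
lemma reducedNorm_sum (D : TwoPlaceSplitting k A) {ι : Type*} [Fintype ι] (b : ι → A) (x : ι → k) :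
    2 * reducedNorm k (∑ i, x i • b i) = ∑ i, ∑ j, x i * x j *
      (reducedTrace k (b i) * reducedTrace k (b j) - reducedTrace k (b i * b j)) := by
  have h2 : ∀ a : A, 2 * reducedNorm k a = reducedTrace k a * reducedTrace k a
      - reducedTrace k (a * a) := by
    intro a
    apply D.place₁.injective
    simp only [map_mul, map_sub, map_ofNat, place₁_reducedNorm, place₁_reducedTrace,
      Matrix.det_fin_two, Matrix.trace_fin_two, Matrix.mul_apply, Fin.sum_univ_two]
    ring
  rw [h2]
  have h3 : reducedTrace k (∑ i, x i • b i) = ∑ i, x i * reducedTrace k (b i) := by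
    simp [← D.traceForm_apply]
  have h4 : reducedTrace k ((∑ i, x i • b i) * (∑ i, x i • b i)) =
      ∑ i, ∑ j, x i * x j * reducedTrace k (b i * b j) := by
    rw [Finset.sum_mul_sum]
    simp only [← D.traceForm_apply, map_sum, smul_mul_smul, map_smul, smul_eq_mul]
  rw [h3, h4, Finset.sum_mul_sum, ← Finset.sum_sub_distrib]
  refine Finset.sum_congr rfl fun i _ => ?_
  rw [← Finset.sum_sub_distrib]
  refine Finset.sum_congr rfl fun j _ => ?_
  ring

lemma mem_scalar_of_smul_one {φ : k →+* ℝ} (a : A) (r : ℝ)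
    (h : letI := φ.toAlgebra; (1 : ℝ) ⊗ₜ[k] a = r • (1 : ℝ ⊗[k] A)) :
    ∃ x : k, a = algebraMap k A x := by
  let := φ.toAlgebra
  by_contra hne
  have hlin : LinearIndependent k ![1, a] := by
    rw [LinearIndependent.pair_iff' one_ne_zero]
    intro x hx
    exact hne ⟨x, by rw [Algebra.algebraMap_eq_smul_one, hx]⟩
  have hl : LinearIndependent ℝ (fun i => ((1 : ℝ) ⊗ₜ[k] (![1, a] : Fin 2 → A) i)) :=
    Module.Flat.linearIndependent_one_tmul hlin
  rw [Fintype.linearIndependent_iff] at hl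
  have := hl ![-r, 1] (by
    rw [Fin.sum_univ_two]
    have h1 : (1 : ℝ) ⊗ₜ[k] (1 : A) = 1 := rfl
    simp only [Matrix.cons_val_zero, Matrix.cons_val_one, h, h1]
    simp) 1
  simp at this

/-- At a ramified place the reduced characteristic polynomial has no two distinct real roots. -/
lemma sq_reducedTrace_le (D : TwoPlaceSplitting k A) {φ : k →+* ℝ} (h₁ : φ ≠ D.place₁)
    (h₂ : φ ≠ D.place₂) (a : A) :
    φ (reducedTrace k a) ^ 2 ≤ 4 * φ (reducedNorm k a) := by
  let := φ.toAlgebra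
  have hdiv := D.ramified φ h₁ h₂
  by_contra! hlt
  set t := φ (reducedTrace k a) with ht
  set n := φ (reducedNorm k a) with hn
  have hsq : Real.sqrt (t ^ 2 - 4 * n) ^ 2 = t ^ 2 - 4 * n := Real.sq_sqrt (by linarith)
  set d := Real.sqrt (t ^ 2 - 4 * n) with hd
  set y : ℝ ⊗[k] A := 1 ⊗ₜ[k] a with hy
  have hscal : ∀ x : k, (1 : ℝ) ⊗ₜ[k] (algebraMap k A x) = (φ x) • (1 : ℝ ⊗[k] A) := by
    intro x
    rw [Algebra.algebraMap_eq_smul_one, TensorProduct.tmul_smul, TensorProduct.smul_tmul',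
      Algebra.TensorProduct.one_def, TensorProduct.smul_tmul', Algebra.smul_def]
    simp
    rfl
  have hyy : y * y = t • y - n • 1 := by
    rw [hy, Algebra.TensorProduct.tmul_mul_tmul, D.mul_self_eq, TensorProduct.tmul_sub, one_mul,
      hscal, Algebra.smul_def]
    congr 1
    have : (1 : ℝ) ⊗ₜ[k] (algebraMap k A (reducedTrace k a) * a) =
      ((1 : ℝ) ⊗ₜ[k] (algebraMap k A (reducedTrace k a))) * (1 ⊗ₜ[k] a) := by
      rw [Algebra.TensorProduct.tmul_mul_tmul, one_mul]
    rw [this, hscal, smul_mul_assoc, one_mul]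
  -- A positive discriminant factors the quadratic equation of $y$ over $\mathbb{R}$. Without zero
  -- divisors $y$ is a real scalar, so $a$ lies in $k$, and then the discriminant is zero.
  have hprod : (y - ((t + d) / 2) • 1) * (y - ((t - d) / 2) • 1) = 0 := by
    rw [sub_mul, mul_sub, mul_sub, hyy]
    simp only [mul_smul_comm, smul_mul_assoc, mul_one, one_mul, smul_smul]
    have : (t - d) / 2 * ((t + d) / 2) = n := by nlinarith
    rw [this]
    module
  have hroot : ∃ r : ℝ, y = r • 1 := by
    by_contra hne
    push Not at hne
    have hu := hdiv _ (sub_ne_zero.2 (hne ((t + d) / 2)))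
    have := hu.mul_right_eq_zero.1 hprod
    exact hne _ (sub_eq_zero.1 this)
  obtain ⟨r, hr⟩ := hroot
  obtain ⟨x, rfl⟩ := mem_scalar_of_smul_one a r hr
  rw [ht, hn, D.reducedTrace_algebraMap, D.reducedNorm_algebraMap] at hlt
  simp only [map_mul, map_pow, map_ofNat] at hlt
  nlinarith

/-- The eigenvalues of `ρ₁ a` are algebraic integers if `a` is integral over `ℤ`. -/
lemma isIntegral_reducedTrace (D : TwoPlaceSplitting k A) {a : A} (ha : IsIntegral ℤ a) :
    IsIntegral ℤ (reducedTrace k a) := by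
  -- Over $\mathbb{C}$ the trace is the sum of the eigenvalues, and each of these is a root of the
  -- monic integral polynomial that kills $a$.
  let ρ : A →+* Matrix (Fin 2) (Fin 2) ℂ := (Complex.ofRealHom.mapMatrix).comp D.rep₁
  obtain ⟨p, hp, hpa⟩ := ha
  have hpa' : Polynomial.aeval (ρ a) p = 0 := by
    rw [Polynomial.aeval_def]
    have := congrArg ρ hpa
    rw [Polynomial.hom_eval₂, map_zero] at this
    convert this using 2
    exact Subsingleton.elim _ _
  have hroots : ∀ z ∈ (ρ a).charpoly.roots, IsIntegral ℤ z := by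
    intro z hz
    have hz' := Polynomial.isRoot_of_mem_roots hz
    refine ⟨p, hp, ?_⟩
    have hev : z ∈ spectrum ℂ (ρ a) := by
      rw [Matrix.mem_spectrum_iff_isRoot_charpoly]; exact hz'
    have hpa'' : Polynomial.aeval (ρ a) (p.map (algebraMap ℤ ℂ)) = 0 := by
      rw [Polynomial.aeval_map_algebraMap, hpa']
    have := spectrum.subset_polynomial_aeval (ρ a) (p.map (algebraMap ℤ ℂ))
      ⟨z, hev, rfl⟩
    rw [hpa'', spectrum.zero_eq] at this
    simpa [Polynomial.eval_map] using this
  have htr : IsIntegral ℤ (ρ a).trace := by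
    rw [Matrix.trace_eq_sum_roots_charpoly]
    exact IsIntegral.multiset_sum hroots
  have hmap : (ρ a).trace = (Complex.ofRealHom.comp D.place₁) (reducedTrace k a) := by
    simp [ρ, place₁_reducedTrace, Matrix.trace_fin_two]
  rw [hmap] at htr
  exact (isIntegral_algHom_iff
    ((Complex.ofRealHom.comp D.place₁).toIntAlgHom) (RingHom.injective _)).1 htr

end TwoPlaceSplitting

end Trace

/-! ### Integrality and finiteness in orders -/

section Orders

variable {k : Type*} [Field k] {A : Type*} [DivisionRing A] [Algebra k A]
  {O : Subring A}

lemma IsOrder.isIntegral (hO : IsOrder k O) {a : A} (ha : a ∈ O) : IsIntegral ℤ a := by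
  refine IsIntegral.of_mem_of_fg (subalgebraOfSubring O) ?_ a ha
  rw [Submodule.fg_iff_addSubgroup_fg]
  exact hO.2.1

lemma IsOrder.algebraMap_mem (hO : IsOrder k O) {x : k} (hx : IsIntegral ℤ x) :
    algebraMap k A x ∈ O :=
  hO.1 ⟨x, hx⟩

lemma IsOrder.isIntegral_reducedTrace (hO : IsOrder k O) (D : TwoPlaceSplitting k A) {a : A}
    (ha : a ∈ O) : IsIntegral ℤ (reducedTrace k a) :=
  D.isIntegral_reducedTrace (hO.isIntegral ha)

lemma IsOrder.conj_mem (hO : IsOrder k O) (D : TwoPlaceSplitting k A) {a : A} (ha : a ∈ O) :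
    algebraMap k A (reducedTrace k a) - a ∈ O :=
  O.sub_mem (hO.algebraMap_mem (hO.isIntegral_reducedTrace D ha)) ha

lemma IsOrder.isIntegral_reducedNorm (hO : IsOrder k O) (D : TwoPlaceSplitting k A) {a : A}
    (ha : a ∈ O) : IsIntegral ℤ (reducedNorm k a) := by
  have h := hO.isIntegral (O.mul_mem ha (hO.conj_mem D ha))
  rw [D.mul_conj] at h
  exact (isIntegral_algHom_iff ((algebraMap k A).toIntAlgHom) (algebraMap k A).injective).1 h

lemma IsOrder.exists_basis (hO : IsOrder k O) (hA : Module.finrank k A = 4) :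
    ∃ b : Module.Basis (Fin 2 × Fin 2) k A, ∀ i, b i ∈ O := by
  have : Module.Finite k A := Module.finite_of_finrank_pos (by omega)
  let b := Module.Basis.ofSpan hO.2.2.ge
  have hb : ∀ i, b i ∈ O := fun i => Module.Basis.ofSpan_subset hO.2.2.ge ⟨i, rfl⟩
  have := Module.Finite.finite_basis b
  have := Fintype.ofFinite ((linearIndepOn_empty k (id : A → A)).extend (Set.empty_subset (O : Set A)))
  have hcard := Module.finrank_eq_card_basis b
  let e := Fintype.equivOfCardEq (β := Fin 2 × Fin 2) (hcard.symm.trans (by rw [hA]; rfl))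
  exact ⟨b.reindex e, fun i => by rw [Module.Basis.reindex_apply]; exact hb _⟩

lemma exists_real_embedding [NumberField.IsTotallyReal k] (φ : k →+* ℂ) :
    ∃ ψ : k →+* ℝ, ∀ x, φ x = (ψ x : ℂ) :=
  have h := NumberField.IsTotallyReal.complexEmbedding_isReal φ
  ⟨h.embedding, fun x => (h.coe_embedding_apply x).symm⟩

lemma card_real_embedding [NumberField k] [NumberField.IsTotallyReal k] :
    Fintype.card (k →+* ℝ) = Module.finrank ℚ k := by
  rw [← NumberField.Embeddings.card k ℂ]
  refine Fintype.card_of_bijective (f := fun φ : k →+* ℝ => Complex.ofRealHom.comp φ) ⟨?_, ?_⟩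
  · intro φ ψ h
    ext x
    simpa using congrArg (fun f : k →+* ℂ => f x) h
  · intro φ
    obtain ⟨ψ, hψ⟩ := exists_real_embedding φ
    exact ⟨ψ, by ext x; simp [hψ]⟩

lemma finite_integral_bounded [NumberField k] [NumberField.IsTotallyReal k] (C : ℝ) :
    {x : k | IsIntegral ℤ x ∧ ∀ φ : k →+* ℝ, |φ x| ≤ C}.Finite := by
  refine (NumberField.Embeddings.finite_of_norm_le k ℂ C).subset fun x hx => ⟨hx.1, fun φ => ?_⟩
  obtain ⟨ψ, hψ⟩ := exists_real_embedding φ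
  simpa [hψ] using hx.2 ψ

/-- The numbers $\mathrm{tr}(ub_i)$ are integral with bounded conjugates, hence finitely many. They
determine $u$: the trace form is nondegenerate, since a nonzero $x$ pairs with $x^{-1}$ to
$\mathrm{tr}(1)=2$. -/
lemma IsOrder.finite_trace_bounded [NumberField k] [NumberField.IsTotallyReal k] (hO : IsOrder k O)
    (D : TwoPlaceSplitting k A) {ι : Type*} [Finite ι] (b : Module.Basis ι k A)
    (hb : ∀ i, b i ∈ O) (C : ℝ) :
    {u : A | u ∈ O ∧ ∀ i, ∀ φ : k →+* ℝ, |φ (reducedTrace k (u * b i))| ≤ C}.Finite := by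
  have hfin : (Set.pi Set.univ (fun _ : ι =>
      {x : k | IsIntegral ℤ x ∧ ∀ φ : k →+* ℝ, |φ x| ≤ C})).Finite :=
    Set.Finite.pi fun _ => finite_integral_bounded C
  refine Set.Finite.of_finite_image (f := fun u i => reducedTrace k (u * b i)) (hfin.subset ?_) ?_
  · rintro _ ⟨u, hu, rfl⟩ i -
    exact ⟨hO.isIntegral_reducedTrace D (O.mul_mem hu.1 (hb i)), hu.2 i⟩
  · intro u _ v _ huv
    by_contra hne
    have hz : D.traceForm ∘ₗ LinearMap.mulLeft k (u - v) = 0 := by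
      refine b.ext fun i => ?_
      have := congrFun huv i
      simp only [← D.traceForm_apply] at this
      simp [sub_mul, this]
    have h1 := LinearMap.congr_fun hz (u - v)⁻¹
    have h2 := D.reducedTrace_algebraMap (1 : k)
    rw [map_one, ← mul_inv_cancel₀ (sub_ne_zero.2 hne)] at h2
    rw [LinearMap.comp_apply, LinearMap.mulLeft_apply, D.traceForm_apply, h2] at h1
    simp at h1

lemma abs_trace_mul_le {R : ℝ} {M : Matrix (Fin 2) (Fin 2) ℝ} (hM : ∀ i j, |M i j| ≤ R)
    (N : Matrix (Fin 2) (Fin 2) ℝ) : |(M * N).trace| ≤ R * ∑ i, ∑ j, |N i j| := by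
  have h : (M * N).trace = ∑ i, ∑ j, M i j * N j i := by
    simp [Matrix.trace, Matrix.mul_apply]
  rw [h, Finset.sum_comm, Finset.mul_sum]
  refine (Finset.abs_sum_le_sum_abs _ _).trans (Finset.sum_le_sum fun j _ => ?_)
  rw [Finset.mul_sum]
  refine (Finset.abs_sum_le_sum_abs _ _).trans (Finset.sum_le_sum fun i _ => ?_)
  rw [abs_mul]
  exact mul_le_mul_of_nonneg_right (hM i j) (abs_nonneg _)

/-- Discreteness of $\mathcal{O}^1$ in $SL_2(\mathbb{R})^2$. The ramified places impose no extra
condition: there $\mathrm{tr}(ub)^2\le4\,\mathrm{nrd}(ub)=4\,\mathrm{nrd}(b)$. -/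
theorem TwoPlaceSplitting.finite_normOneUnits_bounded [NumberField k] [NumberField.IsTotallyReal k]
    (D : TwoPlaceSplitting k A) (hO : IsOrder k O) (hA : Module.finrank k A = 4) (R : ℝ) :
    {u : Aˣ | u ∈ D.normOneUnits O ∧ ∀ i j, |D.rep₁ u i j| ≤ R ∧ |D.rep₂ u i j| ≤ R}.Finite := by
  obtain ⟨b, hb⟩ := hO.exists_basis hA
  obtain ⟨C, hC⟩ := Finite.exists_le (fun x : (Fin 2 × Fin 2) × (k →+* ℝ) =>
    max (max (R * ∑ i, ∑ j, |D.rep₁ (b x.1) i j|) (R * ∑ i, ∑ j, |D.rep₂ (b x.1) i j|))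
      -- From $t^2\le4n$ one gets $|t|\le t^2+1\le4n+1$, which avoids a square root.
      (4 * x.2 (reducedNorm k (b x.1)) + 1))
  refine Set.Finite.of_finite_image (f := fun u : Aˣ => (u : A))
    ((hO.finite_trace_bounded D b hb C).subset ?_) Units.val_injective.injOn
  rintro _ ⟨u, ⟨hu, hR⟩, rfl⟩
  refine ⟨hu.1, fun i φ => (?_ : _ ≤ _).trans (hC (i, φ))⟩
  by_cases h₁ : φ = D.place₁
  · refine le_max_of_le_left (le_max_of_le_left ?_)
    rw [h₁, D.place₁_reducedTrace, map_mul]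
    exact abs_trace_mul_le (fun i j => (hR i j).1) _
  by_cases h₂ : φ = D.place₂
  · refine le_max_of_le_left (le_max_of_le_right ?_)
    rw [h₂, D.place₂_reducedTrace, map_mul]
    exact abs_trace_mul_le (fun i j => (hR i j).2) _
  · refine le_max_of_le_right ?_
    have := D.sq_reducedTrace_le h₁ h₂ (u * b i)
    rw [D.nrd_mul, hu.2.2, one_mul] at this
    simp only
    rw [abs_le]
    constructor <;> nlinarith

end Orders

/-! ### Proper discontinuity of the norm-one group -/

section Discontinuity

open UpperHalfPlane

/-- The action of $SL_2(\mathbb{R})$ on $\mathbb{H}$ is proper, so the elements carrying a point of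
$K$ into $L$ lie in a compact set. -/
lemma exists_entry_bound {K L : Set ℍ} (hK : IsCompact K) (hL : IsCompact L) :
    ∃ R : ℝ, ∀ g : SL(2, ℝ), ∀ z ∈ K, g • z ∈ L → ∀ i j, |g i j| ≤ R := by
  have hc := (ProperSMul.isProperMap_smul_pair (G := SL(2, ℝ)) (X := ℍ)).isCompact_preimage
    (hL.prod hK)
  have hcont : Continuous (fun p : SL(2, ℝ) × ℍ => ∑ i, ∑ j, |p.1 i j|) := by
    refine continuous_finsetSum _ fun i _ => continuous_finsetSum _ fun j _ => ?_
    exact continuous_abs.comp ((continuous_subtype_val.comp continuous_fst).matrix_elem i j)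
  obtain ⟨R, hR⟩ := hc.bddAbove_image hcont.continuousOn
  refine ⟨R, fun g z hz hgz i j => le_trans ?_ (hR ⟨(g, z), ⟨hgz, hz⟩, rfl⟩)⟩
  exact (Finset.single_le_sum (f := fun j => |g i j|) (fun _ _ => abs_nonneg _)
    (Finset.mem_univ j)).trans (Finset.single_le_sum (f := fun i => ∑ j, |g i j|)
      (fun _ _ => Finset.sum_nonneg fun _ _ => abs_nonneg _) (Finset.mem_univ i))

lemma sl_smul_eq_gl_smul (g : SL(2, ℝ)) (h : GL (Fin 2) ℝ)
    (hgh : (g : Matrix (Fin 2) (Fin 2) ℝ) = h) (z : ℍ) : g • z = h • z := by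
  rw [MulAction.compHom_smul_def]
  congr 1
  ext1
  simpa using hgh

variable {k : Type*} [Field k] {A : Type*} [DivisionRing A] [Algebra k A]

namespace TwoPlaceSplitting

variable (D : TwoPlaceSplitting k A)

/-- The image of a unit in `GL₂(ℝ)` at the first split place. -/
def gl₁ : Aˣ →* GL (Fin 2) ℝ := Units.map D.rep₁.toMonoidHom

/-- The image of a unit in `GL₂(ℝ)` at the second split place. -/
def gl₂ : Aˣ →* GL (Fin 2) ℝ := Units.map D.rep₂.toMonoidHom

lemma unitsAct_apply (u : Aˣ) (p : ℍ × ℍ) :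
    D.unitsAct u p = (D.gl₁ u • p.1, D.gl₂ u • p.2) := rfl

lemma act_mk (u : Aˣ) (p : ℍ × ℍ) :
    D.act (QuotientGroup.mk' (scalarUnits k A) u) p = (D.gl₁ u • p.1, D.gl₂ u • p.2) := rfl

/-- The action of `Aˣ / kˣ` on `ℍ × ℍ` as a `MulAction`. -/
abbrev mulAction : MulAction (ProjUnits k A) (ℍ × ℍ) := MulAction.compHom _ D.act

lemma continuous_act (γ : ProjUnits k A) : Continuous (D.act γ) := by
  obtain ⟨u, rfl⟩ := QuotientGroup.mk'_surjective _ γ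
  have : ⇑(D.act (QuotientGroup.mk' (scalarUnits k A) u)) =
    fun p => (D.gl₁ u • p.1, D.gl₂ u • p.2) := rfl
  rw [this]
  fun_prop

lemma continuousConstSMul : letI := D.mulAction; ContinuousConstSMul (ProjUnits k A) (ℍ × ℍ) :=
  letI := D.mulAction
  ⟨fun γ => D.continuous_act γ⟩

/-- The groups `O¹ / {±1}`. -/
abbrev projNormOne (O : Subring A) : Subgroup (ProjUnits k A) :=
  (D.normOneUnits O).map (QuotientGroup.mk' (scalarUnits k A))

lemma exists_SL_of_norm_one {u : Aˣ} (hu : reducedNorm k (u : A) = 1) :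
    ∃ g₁ g₂ : SL(2, ℝ), (g₁ : Matrix (Fin 2) (Fin 2) ℝ) = D.rep₁ u ∧
      (g₂ : Matrix (Fin 2) (Fin 2) ℝ) = D.rep₂ u ∧
      (∀ z : ℍ, g₁ • z = D.gl₁ u • z) ∧ ∀ z : ℍ, g₂ • z = D.gl₂ u • z := by
  refine ⟨⟨D.rep₁ u, by rw [← D.place₁_reducedNorm, hu, map_one]⟩,
    ⟨D.rep₂ u, by rw [← D.place₂_reducedNorm, hu, map_one]⟩, rfl, rfl,
    sl_smul_eq_gl_smul _ _ rfl, sl_smul_eq_gl_smul _ _ rfl⟩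

theorem properlyDiscontinuous_normOne [NumberField k] [NumberField.IsTotallyReal k] {O : Subring A}
    (hO : IsOrder k O) (hA : Module.finrank k A = 4) :
    letI := D.mulAction
    ProperlyDiscontinuousSMul (D.projNormOne O) (ℍ × ℍ) := by
  let := D.mulAction
  rw [Subgroup.properlyDiscontinuousSMul_iff]
  intro K L hK hL
  obtain ⟨R₁, hR₁⟩ := exists_entry_bound (hK.image continuous_fst) (hL.image continuous_fst)
  obtain ⟨R₂, hR₂⟩ := exists_entry_bound (hK.image continuous_snd) (hL.image continuous_snd)
  refine ((D.finite_normOneUnits_bounded hO hA (max R₁ R₂)).image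
    (QuotientGroup.mk' (scalarUnits k A))).subset ?_
  rintro γ ⟨⟨u, hu, rfl⟩, _, ⟨p, hp, rfl⟩, hpL⟩
  refine ⟨u, ⟨hu, fun i j => ?_⟩, rfl⟩
  obtain ⟨g₁, g₂, h₁, h₂, ha₁, ha₂⟩ := D.exists_SL_of_norm_one hu.2.2
  rw [← h₁, ← h₂]
  refine ⟨le_max_of_le_left (hR₁ g₁ p.1 ⟨p, hp, rfl⟩ ?_ i j),
    le_max_of_le_right (hR₂ g₂ p.2 ⟨p, hp, rfl⟩ ?_ i j)⟩
  · exact ⟨_, hpL, (ha₁ _).symm⟩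
  · exact ⟨_, hpL, (ha₂ _).symm⟩

end TwoPlaceSplitting

end Discontinuity

/-! ### An order as a lattice in $A\otimes\mathbb{R}$, and Minkowski's theorem -/

section Lattice

variable {k : Type*} [Field k] {A : Type*} [DivisionRing A] [Algebra k A]

/-- The matrix $(\varphi_s(\omega_t))$ is square because $k$ is totally real, and its rows are
independent by Dedekind's independence of characters; so it is invertible. -/
lemma eq_zero_of_sum_embedding_eq_zero [NumberField k] [NumberField.IsTotallyReal k]
    {ι : Type*} [Fintype ι] (ω : Module.Basis ι ℚ k) (c : ι → ℝ)
    (hc : ∀ φ : k →+* ℝ, ∑ s, c s * φ (ω s) = 0) : c = 0 := by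
  classical
  have hcard : Fintype.card ι = Fintype.card (k →+* ℝ) := by
    rw [card_real_embedding, Module.finrank_eq_card_basis ω]
  let e : ι ≃ (k →+* ℝ) := Fintype.equivOfCardEq hcard
  let W : Matrix ι ι ℝ := Matrix.of fun s t => e s (ω t)
  have hrows : LinearIndependent ℝ W.row := by
    rw [Fintype.linearIndependent_iff]
    intro d hd
    have hli : LinearIndependent ℝ (fun s : ι => ((e s : k →* ℝ) : k → ℝ)) := by
      refine (linearIndependent_monoidHom k ℝ).comp (fun s : ι => ((e s : k →+* ℝ) : k →* ℝ)) ?_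
      intro s t hst
      apply e.injective
      ext x
      exact DFunLike.congr_fun hst x
    rw [Fintype.linearIndependent_iff] at hli
    refine hli d (funext fun x => ?_)
    have hx : ∀ t, ∑ s, d s * e s (ω t) = 0 := by
      intro t
      have := congrFun hd t
      simpa [W, Finset.sum_apply] using this
    have hrepr := ω.sum_repr x
    rw [Finset.sum_apply]
    change ∑ s, d s * e s x = 0
    rw [← hrepr]
    simp only [map_sum, map_rat_smul, Finset.mul_sum]
    rw [Finset.sum_comm]
    refine Finset.sum_eq_zero fun t _ => ?_
    simp only [mul_smul_comm, ← Finset.smul_sum, hx, smul_zero]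
  have hW := Matrix.linearIndependent_rows_iff_isUnit.1 hrows
  apply Matrix.mulVec_injective_iff_isUnit.2 hW
  rw [Matrix.mulVec_zero]
  funext s
  rw [Pi.zero_apply, ← hc (e s)]
  simp [Matrix.mulVec, dotProduct, W, mul_comm]

namespace TwoPlaceSplitting

variable (D : TwoPlaceSplitting k A) (b : Module.Basis (Fin 2 × Fin 2) k A)

open Classical in
/-- Real coordinates on the completion of `A` at a real place: the splitting at the two split
places, and the coordinates with respect to a basis at the other ones. -/
def localRep (φ : k →+* ℝ) : A →+ Matrix (Fin 2) (Fin 2) ℝ :=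
  if φ = D.place₁ then D.rep₁.toAddMonoidHom
  else if φ = D.place₂ then D.rep₂.toAddMonoidHom
  else
    { toFun := fun x => Matrix.of fun i j => φ (b.repr x (i, j))
      map_zero' := by ext; simp
      map_add' := fun x y => by ext; simp }

lemma localRep_place₁ (x : A) : D.localRep b D.place₁ x = D.rep₁ x := by
  simp [localRep]

lemma localRep_place₂ (x : A) : D.localRep b D.place₂ x = D.rep₂ x := by
  simp [localRep, D.place_ne.symm]

lemma localRep_of_ne {φ : k →+* ℝ} (h₁ : φ ≠ D.place₁) (h₂ : φ ≠ D.place₂) (x : A) (i j : Fin 2) :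
    D.localRep b φ x i j = φ (b.repr x (i, j)) := by
  simp [localRep, h₁, h₂]

lemma localRep_smul (φ : k →+* ℝ) (c : k) (x : A) :
    D.localRep b φ (c • x) = φ c • D.localRep b φ x := by
  by_cases h₁ : φ = D.place₁
  · subst h₁; simp only [localRep_place₁, rep₁_smul]
  by_cases h₂ : φ = D.place₂
  · subst h₂; simp only [localRep_place₂, rep₂_smul]
  ext i j
  simp [localRep_of_ne, h₁, h₂]

lemma linearIndependent_localRep (φ : k →+* ℝ) :
    LinearIndependent ℝ (fun t => D.localRep b φ (b t)) := by
  by_cases h₁ : φ = D.place₁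
  · subst h₁; simpa only [localRep_place₁] using D.linearIndependent_rep₁ b.linearIndependent
  by_cases h₂ : φ = D.place₂
  · subst h₂; simpa only [localRep_place₂] using D.linearIndependent_rep₂ b.linearIndependent
  rw [Fintype.linearIndependent_iff]
  rintro g hg ⟨i, j⟩
  have := congrFun (congrFun hg i) j
  rw [Matrix.sum_apply] at this
  simpa [localRep_of_ne, h₁, h₂, Finsupp.single_apply, apply_ite φ] using this

/-- The index set of the real coordinates of `A ⊗ ℝ`: the column, the place, and the row. -/
abbrev CoordIndex (k : Type*) [Field k] : Type _ := Fin 2 × ((k →+* ℝ) × Fin 2)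

/-- The embedding of `A` into `A ⊗ ℝ` in coordinates. -/
def coords : A →+ (CoordIndex k → ℝ) where
  toFun x p := D.localRep b p.2.1 x p.2.2 p.1
  map_zero' := by funext; simp
  map_add' x y := by funext; simp

lemma coords_apply (x : A) (p : CoordIndex k) :
    D.coords b x p = D.localRep b p.2.1 x p.2.2 p.1 := rfl

lemma linearIndependent_coords [NumberField k] [NumberField.IsTotallyReal k]
    {ι : Type*} [Fintype ι] (ω : Module.Basis ι ℚ k) :
    LinearIndependent ℝ (fun p : ι × (Fin 2 × Fin 2) => D.coords b (ω p.1 • b p.2)) := by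
  rw [Fintype.linearIndependent_iff]
  rintro c hc ⟨s, t⟩
  have key : ∀ φ : k →+* ℝ, ∀ t, ∑ s, c (s, t) * φ (ω s) = 0 := by
    intro φ
    have hli := D.linearIndependent_localRep b φ
    rw [Fintype.linearIndependent_iff] at hli
    refine hli (fun t => ∑ s, c (s, t) * φ (ω s)) ?_
    ext i j
    have := congrFun hc (j, (φ, i))
    rw [Finset.sum_apply, Fintype.sum_prod_type_right] at this
    simp only [Pi.smul_apply, coords_apply, localRep_smul, Matrix.smul_apply,
      smul_eq_mul, Pi.zero_apply] at this
    simp only [Matrix.sum_apply, Matrix.smul_apply, smul_eq_mul, Matrix.zero_apply,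
      Finset.sum_mul]
    rw [← this]
    exact Finset.sum_congr rfl fun t _ => Finset.sum_congr rfl fun s _ => by ring
  exact congrFun (eq_zero_of_sum_embedding_eq_zero ω (fun s => c (s, t)) fun φ => key φ t) s

open Classical in
/-- Right multiplication by matrices at the places, in coordinates. -/
def rightMul [NumberField k] (g : (k →+* ℝ) → Matrix (Fin 2) (Fin 2) ℝ) :
    (CoordIndex k → ℝ) →ₗ[ℝ] (CoordIndex k → ℝ) :=
  Matrix.toLin' (Matrix.blockDiagonal fun q : (k →+* ℝ) × Fin 2 => (g q.1).transpose)

/-- Each row of the matrix at a place $\varphi$ is transformed by $g_\varphi^{T}$, which gives one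
unimodular block per place and row. Hence the translation preserves volume. -/
lemma det_rightMul [NumberField k] (g : (k →+* ℝ) → Matrix (Fin 2) (Fin 2) ℝ)
    (hg : ∀ φ, (g φ).det = 1) : LinearMap.det (rightMul g) = 1 := by
  classical
  rw [rightMul, LinearMap.det_toLin', Matrix.det_blockDiagonal]
  simp [hg]

lemma rightMul_coords [NumberField k] (g : (k →+* ℝ) → Matrix (Fin 2) (Fin 2) ℝ) (x : A)
    (φ : k →+* ℝ) (i j : Fin 2) :
    rightMul g (D.coords b x) (j, (φ, i)) = (D.localRep b φ x * g φ) i j := by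
  classical
  simp only [rightMul, Matrix.toLin'_apply, Matrix.mulVec, dotProduct, Matrix.mul_apply,
    Fintype.sum_prod_type, Matrix.blockDiagonal_apply, coords_apply, ite_mul, zero_mul,
    Matrix.transpose_apply]
  refine Finset.sum_congr rfl fun l _ => ?_
  rw [Finset.sum_eq_single φ, Finset.sum_eq_single i]
  · simp [mul_comm]
  · intro i' _ hi'
    simp [hi'.symm]
  · simp
  · intro φ' _ hφ'
    simp [hφ'.symm]
  · simp

open MeasureTheory in
/-- Minkowski's theorem for the translates of an order. -/
theorem exists_mem_order_bounded [NumberField k] [NumberField.IsTotallyReal k] {O : Subring A}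
    (hO : IsOrder k O) (hb : ∀ i, b i ∈ O) :
    ∃ R : ℝ, 0 ≤ R ∧ ∀ g : (k →+* ℝ) → Matrix (Fin 2) (Fin 2) ℝ, (∀ φ, (g φ).det = 1) →
      ∃ a ∈ O, a ≠ 0 ∧ ∀ φ i j, |(D.localRep b φ a * g φ) i j| ≤ R := by
  classical
  let ω := NumberField.integralBasis k
  let v : (Module.Free.ChooseBasisIndex ℤ (NumberField.RingOfIntegers k)) × (Fin 2 × Fin 2) → A :=
    fun p => ω p.1 • b p.2
  have hv : ∀ p, v p ∈ O := by
    intro p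
    rw [show v p = algebraMap k A (ω p.1) * b p.2 from Algebra.smul_def _ _]
    refine O.mul_mem ?_ (hb _)
    rw [show ω p.1 = _ from NumberField.integralBasis_apply k p.1]
    exact hO.1 _
  have hli := D.linearIndependent_coords b ω
  have hcard : Fintype.card ((Module.Free.ChooseBasisIndex ℤ (NumberField.RingOfIntegers k)) ×
      (Fin 2 × Fin 2)) = Module.finrank ℝ (CoordIndex k → ℝ) := by
    rw [Module.finrank_pi]
    simp only [Fintype.card_prod, Fintype.card_fin]
    rw [card_real_embedding, Module.finrank_eq_card_basis ω]
    ring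
  have : Nonempty (Module.Free.ChooseBasisIndex ℤ (NumberField.RingOfIntegers k)) :=
    ω.index_nonempty
  let B := basisOfLinearIndependentOfCardEqFinrank hli hcard
  have hB : ∀ p, B p = D.coords b (v p) := fun p => by
    simp [B, v]
  have hfund := ZSpan.isAddFundamentalDomain' B (volume : Measure (CoordIndex k → ℝ))
  have : Countable (Submodule.span ℤ (Set.range B)).toAddSubgroup :=
    inferInstanceAs (Countable (Submodule.span ℤ (Set.range B)))
  have hvol : volume (ZSpan.fundamentalDomain B) < ⊤ :=
    (ZSpan.fundamentalDomain_isBounded B).measure_lt_top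
  set V := volume (ZSpan.fundamentalDomain B) with hV
  set N := Fintype.card (CoordIndex k) with hN
  have hN0 : N ≠ 0 := by
    rw [hN, ← Module.finrank_pi ℝ, ← hcard]
    exact Fintype.card_ne_zero
  -- With $V$ the covolume, $R=V+1$ gives $R^N\ge R>V$. The preimage of the cube of side $2R$ thus
  -- has volume $(2R)^N>2^NV$, for all unimodular $g$ at once.
  refine ⟨V.toReal + 1, by positivity, fun g hg => ?_⟩
  set R := V.toReal + 1 with hR
  have hR1 : 1 ≤ R := by rw [hR]; linarith [ENNReal.toReal_nonneg (a := V)]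
  have hdet := det_rightMul g hg
  let s : Set (CoordIndex k → ℝ) := rightMul g ⁻¹' Metric.closedBall 0 R
  have hs : volume s = ENNReal.ofReal ((2 * R) ^ N) := by
    rw [Measure.addHaar_preimage_linearMap _ (by rw [hdet]; exact one_ne_zero), hdet,
      Real.volume_pi_closedBall _ (by linarith)]
    simp [hN]
  have hlt : V * 2 ^ Module.finrank ℝ (CoordIndex k → ℝ) < volume s := by
    have hR0 : 0 ≤ R := by linarith
    rw [hs, Module.finrank_pi, ← hN, mul_comm 2 R, mul_pow,
      ENNReal.ofReal_mul (by positivity), ENNReal.ofReal_pow (p := 2) (by norm_num) N]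
    rw [show ENNReal.ofReal 2 = 2 by simp]
    refine (ENNReal.mul_lt_mul_iff_left (by simp) (by finiteness)).2 ?_
    rw [← ENNReal.ofReal_toReal hvol.ne]
    refine (ENNReal.ofReal_lt_ofReal_iff (by positivity)).2 ?_
    calc V.toReal < R := by rw [hR]; linarith
      _ ≤ R ^ N := le_self_pow₀ hR1 hN0
  have hsymm : ∀ x ∈ s, -x ∈ s := by
    intro x hx
    simpa [s] using hx
  have hconv : Convex ℝ s := (convex_closedBall 0 R).linear_preimage _
  obtain ⟨⟨x, hxL⟩, hx0, hxs⟩ :=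
    exists_ne_zero_mem_lattice_of_measure_mul_two_pow_lt_measure hfund hsymm hconv hlt
  have hxL' : x ∈ Submodule.map (D.coords b).toIntLinearMap (Submodule.span ℤ (Set.range v)) := by
    rw [Submodule.map_span, ← Set.range_comp]
    have : (D.coords b).toIntLinearMap ∘ v = B := by
      funext p
      exact (hB p).symm
    rw [this]
    exact hxL
  obtain ⟨a, ha, rfl⟩ := hxL'
  have hspan : Submodule.span ℤ (Set.range v) ≤ AddSubgroup.toIntSubmodule O.toAddSubgroup := by
    rw [Submodule.span_le]
    rintro _ ⟨p, rfl⟩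
    exact hv p
  refine ⟨a, hspan ha, ?_, fun φ i j => ?_⟩
  · rintro rfl
    apply hx0
    ext1
    simp
  · rw [← D.rightMul_coords b g a φ i j, ← Real.norm_eq_abs]
    have hx' : ‖rightMul g (D.coords b a)‖ ≤ R := mem_closedBall_zero_iff.1 hxs
    exact (norm_le_pi_norm _ _).trans hx'

end TwoPlaceSplitting

end Lattice

/-! ### Elements of given norm modulo units -/

section Representatives

variable {k : Type*} [Field k] {A : Type*} [DivisionRing A] [Algebra k A] {O : Subring A}

/-- Since $t^{-1}=\mathrm{nrd}(t)^{-1}\bar t$, the element $mt^{-1}$ lies in $\mathcal{O}$, and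
$t^{-1}a=1+(mt^{-1})c$. -/
lemma IsOrder.inv_mul_mem (hO : IsOrder k O) (D : TwoPlaceSplitting k A) {m : ℤ} {a t c : A}
    (ht : t ∈ O) (hc : c ∈ O) (ht0 : t ≠ 0) (hm : IsIntegral ℤ (m • (reducedNorm k t)⁻¹))
    (h : a = t + m • c) : t⁻¹ * a ∈ O := by
  have hn := D.reducedNorm_ne_zero ht0
  have hinv : m • t⁻¹ = algebraMap k A (m • (reducedNorm k t)⁻¹) *
      (algebraMap k A (reducedTrace k t) - t) := by
    have h1 : t⁻¹ = algebraMap k A (reducedNorm k t)⁻¹ *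
        (algebraMap k A (reducedTrace k t) - t) := by
      refine eq_comm.1 (eq_inv_of_mul_eq_one_left ?_)
      rw [mul_assoc, D.conj_mul, ← map_mul, inv_mul_cancel₀ hn, map_one]
    rw [map_zsmul, smul_mul_assoc, ← h1]
  rw [h, mul_add, inv_mul_cancel₀ ht0, mul_smul_comm, ← smul_mul_assoc, hinv]
  exact O.add_mem O.one_mem (O.mul_mem (O.mul_mem (hO.algebraMap_mem hm) (hO.conj_mem D ht)) hc)

lemma finite_quotient_zsmul {G : Type*} [AddCommGroup G] [AddGroup.FG G] {m : ℤ} (hm : m ≠ 0) :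
    Finite (G ⧸ (zsmulAddGroupHom m : G →+ G).range) := by
  have : AddGroup.FG (G ⧸ (zsmulAddGroupHom m : G →+ G).range) :=
    QuotientAddGroup.fg _
  refine AddCommGroup.finite_of_fg_isAddTorsion _ fun g => ?_
  obtain ⟨g, rfl⟩ := QuotientAddGroup.mk_surjective g
  rw [isOfFinAddOrder_iff_zsmul_eq_zero]
  refine ⟨m, hm, ?_⟩
  rw [← QuotientAddGroup.mk_zsmul, QuotientAddGroup.eq_zero_iff]
  exact ⟨g, rfl⟩

lemma exists_integral_zsmul [NumberField k] (x : k) : ∃ m : ℤ, m ≠ 0 ∧ IsIntegral ℤ (m • x) := by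
  have h : IsAlgebraic ℤ x := (IsFractionRing.isAlgebraic_iff ℤ ℚ k).2 (Algebra.IsAlgebraic.isAlgebraic x)
  exact h.exists_integral_multiple

/-- Up to units of norm one there are only finitely many elements of an order with given norm. -/
lemma IsOrder.exists_finite_representatives [NumberField k] (hO : IsOrder k O)
    (D : TwoPlaceSplitting k A) (ν : k) (hν : ν ≠ 0) :
    ∃ T : Set A, T.Finite ∧ (∀ t ∈ T, t ≠ 0) ∧ ∀ a ∈ O, reducedNorm k a = ν →
      ∃ t ∈ T, ∃ u ∈ D.normOneUnits O, a = t * u := by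
  -- With $m/\nu$ integral, two elements of norm $\nu$ that are congruent modulo $m\mathcal{O}$
  -- differ by a unit of norm one. One representative for each occurring class of the finite group
  -- $\mathcal{O}/m\mathcal{O}$ suffices.
  obtain ⟨m, hm0, hm⟩ := exists_integral_zsmul (ν⁻¹)
  have : AddGroup.FG O.toAddSubgroup := (AddGroup.fg_iff_addSubgroup_fg _).2 hO.2.1
  let Q := O.toAddSubgroup ⧸ (zsmulAddGroupHom m : O.toAddSubgroup →+ O.toAddSubgroup).range
  have hQ : Finite Q := finite_quotient_zsmul hm0
  let S := {x : O.toAddSubgroup // reducedNorm k (x : A) = ν}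
  let f : S → Q := fun x => QuotientAddGroup.mk x.1
  have hne : ∀ t : A, reducedNorm k t = ν → t ≠ 0 := by
    rintro t ht rfl
    apply hν
    rw [← ht, ← map_zero (algebraMap k A), D.reducedNorm_algebraMap]
    simp
  let s : Set.range f → A := fun q => ((q.2.choose : S) : O.toAddSubgroup)
  refine ⟨Set.range s, Set.finite_range s, ?_, ?_⟩
  · rintro _ ⟨q, rfl⟩
    exact hne _ q.2.choose.2
  · intro a ha han
    let x : S := ⟨⟨a, ha⟩, han⟩
    let q : Set.range f := ⟨f x, x, rfl⟩
    have hq : f q.2.choose = f x := q.2.choose_spec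
    set y : S := q.2.choose with hy
    obtain ⟨⟨c, hc⟩, hcm⟩ := QuotientAddGroup.eq.1 hq
    have hcm' : m • c = -(y : A) + a := congrArg Subtype.val hcm
    have hyO : (y : A) ∈ O := y.1.2
    have hyn : reducedNorm k (y : A) = ν := y.2
    have hy0 := hne _ hyn
    have ha0 := hne _ han
    have h1 : (y : A)⁻¹ * a ∈ O := hO.inv_mul_mem D hyO hc hy0 (by rwa [hyn])
      (by rw [hcm']; abel)
    have h2 : a⁻¹ * (y : A) ∈ O := hO.inv_mul_mem D ha (O.neg_mem hc) ha0 (by rwa [han])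
      (by rw [smul_neg, hcm']; abel)
    refine ⟨y, ⟨q, rfl⟩, Units.mk0 ((y : A)⁻¹ * a) (mul_ne_zero (inv_ne_zero hy0) ha0), ?_, ?_⟩
    · refine ⟨h1, ?_, ?_⟩
      · rw [Units.val_inv_eq_inv_val, Units.val_mk0, mul_inv_rev, inv_inv]
        exact h2
      · have h3 := D.nrd_mul (y : A) ((y : A)⁻¹ * a)
        rw [mul_inv_cancel_left₀ hy0, han, hyn] at h3
        exact mul_left_cancel₀ hν (by rw [Units.val_mk0, ← h3, mul_one])
    · rw [Units.val_mk0, mul_inv_cancel_left₀ hy0]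

end Representatives

/-! ### Cocompactness of the norm-one group -/

section Compactness

open UpperHalfPlane

lemma isCompact_bounded_strip (δ B : ℝ) (hδ : 0 < δ) : IsCompact {z : ℍ | δ ≤ z.im ∧ ‖(z : ℂ)‖ ≤ B} := by
  rw [isEmbedding_coe.isCompact_iff]
  have : ((↑) : ℍ → ℂ) '' {z : ℍ | δ ≤ z.im ∧ ‖(z : ℂ)‖ ≤ B} =
      {z : ℂ | δ ≤ z.im} ∩ Metric.closedBall 0 B := by
    ext z
    simp only [Set.mem_image, Set.mem_ofPred_eq, Set.mem_inter_iff, mem_closedBall_zero_iff]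
    constructor
    · rintro ⟨w, hw, rfl⟩
      exact hw
    · intro hz
      exact ⟨⟨z, hδ.trans_le hz.1⟩, hz, rfl⟩
  rw [this]
  exact (isCompact_closedBall _ _).inter_left (isClosed_le continuous_const Complex.continuous_im)

/-- Matrices in a compact part of `GL₂(ℝ)` move `i` within a compact part of `ℍ`. -/
lemma exists_compact_of_bounded (R ε : ℝ) (hε : 0 < ε) :
    ∃ K : Set ℍ, IsCompact K ∧ ∀ g : GL (Fin 2) ℝ, (∀ i j, |g i j| ≤ R) →
      ε ≤ |g.det.val| → g • I ∈ K := by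
  refine ⟨{z : ℍ | ε / (2 * R ^ 2 + 1) ≤ z.im ∧ ‖(z : ℂ)‖ ≤ 4 * R ^ 2 / ε},
    isCompact_bounded_strip _ _ (by positivity), fun g hR hd => ?_⟩
  have hR0 : 0 ≤ R := (abs_nonneg _).trans (hR 0 0)
  have hsq : ∀ i j, g i j ^ 2 ≤ R ^ 2 := fun i j => sq_le_sq' (abs_le.1 (hR i j)).1 (abs_le.1 (hR i j)).2
  have hden : Complex.normSq (denom g I) = g 1 0 ^ 2 + g 1 1 ^ 2 := by
    simp [denom, Complex.normSq_apply]; ring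
  have hnum : Complex.normSq (num g I) = g 0 0 ^ 2 + g 0 1 ^ 2 := by
    simp [num, Complex.normSq_apply]; ring
  have hdet : g.det.val = g 0 0 * g 1 1 - g 0 1 * g 1 0 := Matrix.det_fin_two _
  have hpos : 0 < g 1 0 ^ 2 + g 1 1 ^ 2 := by
    rw [← hden]; exact normSq_denom_pos g (by simp)
  -- Lagrange's identity; the difference of the two sides is $(ac+bd)^2$. It keeps the denominator
  -- of $g\cdot i$ away from zero.
  have hlag : g.det.val ^ 2 ≤ (g 0 0 ^ 2 + g 0 1 ^ 2) * (g 1 0 ^ 2 + g 1 1 ^ 2) := by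
    rw [hdet]
    nlinarith [sq_nonneg (g 0 0 * g 1 0 + g 0 1 * g 1 1)]
  have hdsq : ε ^ 2 ≤ g.det.val ^ 2 := by
    rw [← sq_abs g.det.val]; exact pow_le_pow_left₀ hε.le hd 2
  have hn2 : g 0 0 ^ 2 + g 0 1 ^ 2 ≤ 2 * R ^ 2 := by linarith [hsq 0 0, hsq 0 1]
  have hd2 : g 1 0 ^ 2 + g 1 1 ^ 2 ≤ 2 * R ^ 2 := by linarith [hsq 1 0, hsq 1 1]
  constructor
  · rw [im_smul_eq_div_normSq, I_im, mul_one, hden]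
    exact div_le_div₀ (abs_nonneg _) hd hpos (by linarith)
  · rw [coe_smul, norm_σ, norm_div]
    refine le_of_sq_le_sq ?_ (by positivity)
    rw [div_pow, ← Complex.normSq_eq_norm_sq, ← Complex.normSq_eq_norm_sq, hnum, hden, div_pow,
      div_le_div_iff₀ hpos (by positivity)]
    have hX : 0 ≤ g 0 0 ^ 2 + g 0 1 ^ 2 := by positivity
    generalize g 0 0 ^ 2 + g 0 1 ^ 2 = X at *
    generalize g 1 0 ^ 2 + g 1 1 ^ 2 = Y at *
    have h1 : ε ^ 2 ≤ X * Y := hdsq.trans hlag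
    calc X * ε ^ 2 ≤ X * (X * Y) := mul_le_mul_of_nonneg_left h1 hX
      _ = X ^ 2 * Y := by ring
      _ ≤ (2 * R ^ 2) ^ 2 * Y := by gcongr
      _ ≤ (4 * R ^ 2) ^ 2 * Y := by gcongr; norm_num

variable {k : Type*} [Field k] {A : Type*} [DivisionRing A] [Algebra k A]

lemma abs_det_le {R : ℝ} {M : Matrix (Fin 2) (Fin 2) ℝ} (hM : ∀ i j, |M i j| ≤ R) :
    |M.det| ≤ 2 * R ^ 2 := by
  rw [Matrix.det_fin_two]
  refine (abs_sub _ _).trans ?_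
  rw [abs_mul, abs_mul]
  nlinarith [mul_le_mul (hM 0 0) (hM 1 1) (abs_nonneg _) ((abs_nonneg _).trans (hM 0 0)),
    mul_le_mul (hM 0 1) (hM 1 0) (abs_nonneg _) ((abs_nonneg _).trans (hM 0 0))]

namespace TwoPlaceSplitting

variable (D : TwoPlaceSplitting k A)

open Classical in
/-- Matrices at the real places that are trivial at the ramified ones. -/
def placeMatrices (g₁ g₂ : SL(2, ℝ)) (φ : k →+* ℝ) : Matrix (Fin 2) (Fin 2) ℝ :=
  if φ = D.place₁ then g₁ else if φ = D.place₂ then g₂ else 1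

/-- At a split place the norm is a determinant, unchanged by the unimodular factor. At a ramified
place it is a quadratic form in the bounded coordinates. -/
lemma exists_reducedNorm_bound [NumberField k] (b : Module.Basis (Fin 2 × Fin 2) k A)
    (R : ℝ) : ∃ C : ℝ, ∀ (g₁ g₂ : SL(2, ℝ)) (a : A),
      (∀ φ i j, |(D.localRep b φ a * D.placeMatrices g₁ g₂ φ) i j| ≤ R) →
      ∀ φ : k →+* ℝ, |φ (reducedNorm k a)| ≤ C := by
  let q : Fin 2 × Fin 2 → Fin 2 × Fin 2 → k := fun s t =>
    reducedTrace k (b s) * reducedTrace k (b t) - reducedTrace k (b s * b t)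
  obtain ⟨C, hC⟩ := Finite.exists_le (fun φ : k →+* ℝ =>
    max (2 * R ^ 2) (∑ s, ∑ t, R * R * |φ (q s t)|))
  refine ⟨C, fun g₁ g₂ a ha φ => (?_ : _ ≤ _).trans (hC φ)⟩
  by_cases h₁ : φ = D.place₁
  · refine le_max_of_le_left ?_
    subst h₁
    rw [place₁_reducedNorm, ← mul_one (Matrix.det _), ← g₁.2, ← Matrix.det_mul]
    exact abs_det_le fun i j => by simpa [localRep_place₁, placeMatrices] using ha D.place₁ i j
  by_cases h₂ : φ = D.place₂
  · refine le_max_of_le_left ?_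
    subst h₂
    rw [place₂_reducedNorm, ← mul_one (Matrix.det _), ← g₂.2, ← Matrix.det_mul]
    exact abs_det_le fun i j => by
      simpa [localRep_place₂, placeMatrices, D.place_ne.symm] using ha D.place₂ i j
  · refine le_max_of_le_right ?_
    have hx : ∀ s, |φ (b.repr a s)| ≤ R := by
      rintro ⟨i, j⟩
      simpa [localRep_of_ne, placeMatrices, h₁, h₂] using ha φ i j
    have hsum := D.reducedNorm_sum b (b.repr a)
    rw [b.sum_repr] at hsum
    have h2 : |φ (reducedNorm k a)| ≤ |φ (2 * reducedNorm k a)| := by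
      rw [map_mul, map_ofNat, abs_mul, abs_two]
      linarith [abs_nonneg (φ (reducedNorm k a))]
    refine h2.trans ?_
    rw [hsum]
    simp only [map_sum, map_mul]
    refine (Finset.abs_sum_le_sum_abs _ _).trans (Finset.sum_le_sum fun s _ => ?_)
    refine (Finset.abs_sum_le_sum_abs _ _).trans (Finset.sum_le_sum fun t _ => ?_)
    rw [abs_mul, abs_mul]
    exact mul_le_mul_of_nonneg_right (mul_le_mul (hx s) (hx t) (abs_nonneg _)
      ((abs_nonneg _).trans (hx s))) (abs_nonneg _)

/-- The unit group of norm one of an order acts cocompactly on `ℍ × ℍ`. -/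
theorem cocompact_normOne [NumberField k] [NumberField.IsTotallyReal k] {O : Subring A}
    (hO : IsOrder k O) (hA : Module.finrank k A = 4) :
    ∃ K : Set (ℍ × ℍ), IsCompact K ∧ ∀ p, ∃ u ∈ D.normOneUnits O, D.unitsAct u p ∈ K := by
  obtain ⟨b, hb⟩ := hO.exists_basis hA
  obtain ⟨R, hR0, hR⟩ := D.exists_mem_order_bounded b hO hb
  obtain ⟨C, hC⟩ := D.exists_reducedNorm_bound b R
  let F : Set k := {ν | ν ≠ 0 ∧ IsIntegral ℤ ν ∧ ∀ φ : k →+* ℝ, |φ ν| ≤ C}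
  have hF : F.Finite := (finite_integral_bounded C).subset fun ν hν => hν.2
  choose! T hTfin hT0 hT using fun (ν : k) (hν : ν ≠ 0) =>
    hO.exists_finite_representatives D ν hν
  let T' : Set A := ⋃ ν ∈ F, T ν
  have hT'fin : T'.Finite := hF.biUnion fun ν hν => hTfin ν hν.1
  let S : Set Aˣ := {v | (v : A) ∈ T'}
  have hS : S.Finite := Set.Finite.preimage Units.val_injective.injOn hT'fin
  have hloc : ∀ v : Aˣ, ∃ K₁ K₂ : Set ℍ, IsCompact K₁ ∧ IsCompact K₂ ∧
      (∀ g : GL (Fin 2) ℝ, (∀ i j, |g i j| ≤ R) → |D.place₁ (reducedNorm k (v : A))| ≤ |g.det.val| →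
        g • I ∈ K₁) ∧
      (∀ g : GL (Fin 2) ℝ, (∀ i j, |g i j| ≤ R) → |D.place₂ (reducedNorm k (v : A))| ≤ |g.det.val| →
        g • I ∈ K₂) := by
    intro v
    have hv := D.reducedNorm_ne_zero v.ne_zero
    obtain ⟨K₁, hK₁, h₁⟩ := exists_compact_of_bounded R _
      (abs_pos.2 ((map_ne_zero D.place₁).2 hv))
    obtain ⟨K₂, hK₂, h₂⟩ := exists_compact_of_bounded R _
      (abs_pos.2 ((map_ne_zero D.place₂).2 hv))
    exact ⟨K₁, K₂, hK₁, hK₂, h₁, h₂⟩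
  choose K₁ K₂ hK₁ hK₂ hm₁ hm₂ using hloc
  -- Let $g$ move $i$ to the given point in each factor, and write the Minkowski element as $a=tu$
  -- with $t$ in the finite set. Then $u$ sends the point to $t^{-1}(ag\cdot i)$, where $ag$ has
  -- bounded entries and determinant of fixed size.
  refine ⟨⋃ v ∈ S, D.unitsAct v⁻¹ '' (K₁ v ×ˢ K₂ v), hS.isCompact_biUnion fun v _ =>
    ((hK₁ v).prod (hK₂ v)).image (D.continuous_act (QuotientGroup.mk' (scalarUnits k A) v⁻¹)), ?_⟩
  rintro ⟨z, w⟩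
  have hdet : ∀ φ, (D.placeMatrices z.toSL2R w.toSL2R φ).det = 1 := by
    intro φ
    unfold placeMatrices
    split_ifs
    · exact z.toSL2R.2
    · exact w.toSL2R.2
    · exact Matrix.det_one
  obtain ⟨a, haO, ha0, ha⟩ := hR _ hdet
  have hνF : reducedNorm k a ∈ F :=
    ⟨D.reducedNorm_ne_zero ha0, hO.isIntegral_reducedNorm D haO, hC _ _ _ ha⟩
  obtain ⟨t, ht, u, hu, hau⟩ := hT _ hνF.1 a haO rfl
  let v : Aˣ := Units.mk0 t (hT0 _ hνF.1 t ht)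
  have hvS : v ∈ S := Set.mem_biUnion hνF ht
  have hva : ((v * u : Aˣ) : A) = a := by rw [hau]; rfl
  have hnva : reducedNorm k (v : A) = reducedNorm k a := by
    rw [hau, D.nrd_mul, hu.2.2, mul_one]; rfl
  refine ⟨u, hu, Set.mem_biUnion hvS ⟨D.unitsAct (v * u) (z, w), ⟨?_, ?_⟩, ?_⟩⟩
  · let g : GL (Fin 2) ℝ := D.gl₁ (v * u) * (z.toSL2R : GL (Fin 2) ℝ)
    have hg : (g : Matrix (Fin 2) (Fin 2) ℝ) = D.rep₁ a * z.toSL2R := by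
      rw [← hva]; rfl
    have hgz : g • I = D.gl₁ (v * u) • z := by
      rw [mul_smul, ← sl_smul_eq_gl_smul z.toSL2R (z.toSL2R : GL (Fin 2) ℝ) rfl, toSL2R_smul_I]
    rw [unitsAct_apply, ← hgz]
    refine hm₁ v g (fun i j => ?_) ?_
    · rw [hg]
      simpa [localRep_place₁, placeMatrices] using ha D.place₁ i j
    · refine le_of_eq ?_
      change _ = |(g : Matrix (Fin 2) (Fin 2) ℝ).det|
      rw [hg, Matrix.det_mul, z.toSL2R.2, mul_one, hnva, place₁_reducedNorm]
  · let g : GL (Fin 2) ℝ := D.gl₂ (v * u) * (w.toSL2R : GL (Fin 2) ℝ)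
    have hg : (g : Matrix (Fin 2) (Fin 2) ℝ) = D.rep₂ a * w.toSL2R := by
      rw [← hva]; rfl
    have hgz : g • I = D.gl₂ (v * u) • w := by
      rw [mul_smul, ← sl_smul_eq_gl_smul w.toSL2R (w.toSL2R : GL (Fin 2) ℝ) rfl, toSL2R_smul_I]
    rw [unitsAct_apply, ← hgz]
    refine hm₂ v g (fun i j => ?_) ?_
    · rw [hg]
      simpa [localRep_place₂, placeMatrices, D.place_ne.symm] using ha D.place₂ i j
    · refine le_of_eq ?_
      change _ = |(g : Matrix (Fin 2) (Fin 2) ℝ).det|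
      rw [hg, Matrix.det_mul, w.toSL2R.2, mul_one, hnva, place₂_reducedNorm]
  · rw [← Equiv.Perm.mul_apply, ← map_mul, inv_mul_cancel_left]

end TwoPlaceSplitting

end Compactness

/-! ### The covering $\mathbb{H}\times\mathbb{H}\to X$ and compactness of $X$ -/

section Surfaces

open UpperHalfPlane

lemma gl_eq_scalar_of_smul_eq {g : GL (Fin 2) ℝ} (hg : 0 < g.det.val) (h : ∀ z : ℍ, g • z = z) :
    (g : Matrix (Fin 2) (Fin 2) ℝ) = (g 0 0) • (1 : Matrix (Fin 2) (Fin 2) ℝ) := by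
  have key : ∀ z : ℍ, (g 0 0 : ℂ) * z + g 0 1 = z * (g 1 0 * z + g 1 1) := by
    intro z
    have h1 := congrArg ((↑) : ℍ → ℂ) (h z)
    rw [coe_smul_of_det_pos hg, div_eq_iff (denom_ne_zero g z)] at h1
    exact h1
  -- The quadratic equation of the fixed points gives $a=d$ and $b=-c$ at $i$, and $b=-4c$ at $2i$.
  have h1 := key I
  have h2 := key ⟨2 * Complex.I, by simp⟩
  have a1 := congrArg Complex.re h1
  have a2 := congrArg Complex.im h1
  have a3 := congrArg Complex.re h2
  simp at a1 a2 a3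
  ext i j
  fin_cases i <;> fin_cases j <;> simp <;> linarith

variable {k : Type*} [Field k] {A : Type*} [DivisionRing A] [Algebra k A]

lemma mem_scalarUnits_of_dependent {u : Aˣ} (h : ¬ LinearIndependent k ![1, (u : A)]) :
    u ∈ scalarUnits k A := by
  rw [LinearIndependent.pair_iff' one_ne_zero] at h
  push Not at h
  obtain ⟨x, hx⟩ := h
  have hx0 : x ≠ 0 := by
    rintro rfl
    rw [zero_smul] at hx
    exact u.ne_zero hx.symm
  exact ⟨Units.mk0 x hx0, by ext; simp [← hx, Algebra.algebraMap_eq_smul_one]⟩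

namespace TwoPlaceSplitting

variable (D : TwoPlaceSplitting k A) {Γ : Subgroup (ProjUnits k A)}

lemma mem_scalarUnits_of_rep₁ {u : Aˣ} {r : ℝ} (h : D.rep₁ u = r • 1) : u ∈ scalarUnits k A := by
  refine mem_scalarUnits_of_dependent fun hli => ?_
  have h1 := D.linearIndependent_rep₁ hli
  have h2 : (fun i => D.rep₁ (![1, (u : A)] i)) = ![D.rep₁ 1, D.rep₁ u] := by
    funext i; fin_cases i <;> rfl
  rw [h2, LinearIndependent.pair_iff] at h1
  simpa using (h1 (-r) 1 (by simp [h])).2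

lemma mem_scalarUnits_of_rep₂ {u : Aˣ} {r : ℝ} (h : D.rep₂ u = r • 1) : u ∈ scalarUnits k A := by
  refine mem_scalarUnits_of_dependent fun hli => ?_
  have h1 := D.linearIndependent_rep₂ hli
  have h2 : (fun i => D.rep₂ (![1, (u : A)] i)) = ![D.rep₂ 1, D.rep₂ u] := by
    funext i; fin_cases i <;> rfl
  rw [h2, LinearIndependent.pair_iff] at h1
  simpa using (h1 (-r) 1 (by simp [h])).2

namespace IsSmoothShimuraGroup

variable {D} (hΓ : D.IsSmoothShimuraGroup Γ)
include hΓ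

lemma exists_unit {γ : ProjUnits k A} (hγ : γ ∈ Γ) :
    ∃ u : Aˣ, QuotientGroup.mk' (scalarUnits k A) u = γ ∧ 0 < (D.gl₁ u).det.val ∧
      0 < (D.gl₂ u).det.val := by
  obtain ⟨u, hu, rfl⟩ := hΓ.le_positive hγ
  refine ⟨u, rfl, ?_, ?_⟩
  · have := hu D.place₁
    rwa [D.place₁_reducedNorm] at this
  · have := hu D.place₂
    rwa [D.place₂_reducedNorm] at this

/-- $\Gamma$ is faithful on each factor: $\rho_1$ preserves the independence of $1,u$, so only
elements of $k$ become scalar matrices. -/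
lemma eq_one_of_fst {γ : ProjUnits k A} (hγ : γ ∈ Γ) (h : ∀ p, (D.act γ p).1 = p.1) : γ = 1 := by
  obtain ⟨u, rfl, hu, -⟩ := hΓ.exists_unit hγ
  rw [QuotientGroup.mk'_apply, QuotientGroup.eq_one_iff]
  exact D.mem_scalarUnits_of_rep₁ (gl_eq_scalar_of_smul_eq hu fun z => h (z, z))

lemma eq_one_of_snd {γ : ProjUnits k A} (hγ : γ ∈ Γ) (h : ∀ p, (D.act γ p).2 = p.2) : γ = 1 := by
  obtain ⟨u, rfl, -, hu⟩ := hΓ.exists_unit hγ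
  rw [QuotientGroup.mk'_apply, QuotientGroup.eq_one_iff]
  exact D.mem_scalarUnits_of_rep₂ (gl_eq_scalar_of_smul_eq hu fun z => h (z, z))

section

variable [NumberField k] [NumberField.IsTotallyReal k] (hA : Module.finrank k A = 4)
include hA

lemma properlyDiscontinuous : letI := D.mulAction; ProperlyDiscontinuousSMul Γ (ℍ × ℍ) := by
  let := D.mulAction
  obtain ⟨O, hO, hcomm⟩ := hΓ.commensurable
  have := D.continuousConstSMul
  exact hcomm.properlyDiscontinuousSMul_iff.2 (D.properlyDiscontinuous_normOne hO.1 hA)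

/-- Stabilizers are finite by proper discontinuity, and $\Gamma$ is torsion-free. -/
lemma eq_one_of_fixed {γ : ProjUnits k A} (hγ : γ ∈ Γ) {p : ℍ × ℍ} (h : D.act γ p = p) : γ = 1 := by
  let := D.mulAction
  have := hΓ.properlyDiscontinuous hA
  have hfin := ProperlyDiscontinuousSMul.finite_stabilizer' (Γ := Γ) p
  have : Finite (MulAction.stabilizer Γ p) := hfin
  have h1 : IsOfFinOrder (⟨⟨γ, hγ⟩, h⟩ : MulAction.stabilizer Γ p) := isOfFinOrder_of_finite _
  refine hΓ.torsionFree γ hγ ?_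
  have h2 := (Γ.subtype.comp (MulAction.stabilizer Γ p).subtype).isOfFinOrder h1
  exact h2

lemma exists_compact : ∃ K : Set (ℍ × ℍ), IsCompact K ∧ ∀ p, ∃ γ ∈ Γ, D.act γ p ∈ K := by
  obtain ⟨O, hO, hcomm⟩ := hΓ.commensurable
  obtain ⟨K, hK, hcov⟩ := D.cocompact_normOne hO.1 hA
  set N := D.projNormOne O with hN
  have hidx : (Γ.subgroupOf N).FiniteIndex := ⟨hcomm.1⟩
  have hfin : Finite (N ⧸ Γ.subgroupOf N) := inferInstance
  -- $\Gamma\cap N$ has finite index in $N$; translating the compact set of $N$ by the inverses of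
  -- coset representatives gives one for $\Gamma$.
  refine ⟨⋃ q : N ⧸ Γ.subgroupOf N, D.act ((q.out : N) : ProjUnits k A)⁻¹ '' K,
    isCompact_iUnion fun q => hK.image (D.continuous_act _), fun p => ?_⟩
  obtain ⟨u, hu, hup⟩ := hcov p
  let n : N := ⟨QuotientGroup.mk' (scalarUnits k A) u, u, hu, rfl⟩
  let q : N ⧸ Γ.subgroupOf N := QuotientGroup.mk n
  have hmem : (q.out)⁻¹ * n ∈ Γ.subgroupOf N := QuotientGroup.eq.1 (QuotientGroup.out_eq' q)
  refine ⟨_, Subgroup.mem_subgroupOf.1 hmem, Set.mem_iUnion.2 ⟨q, D.unitsAct u p, hup, ?_⟩⟩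
  simp [map_mul]
  rfl

end

end IsSmoothShimuraGroup

/-- The group of deck transformations of `ℍ × ℍ → X_Γ`. -/
abbrev deckGroup (Γ : Subgroup (ProjUnits k A)) : Subgroup (Equiv.Perm (ℍ × ℍ)) := Γ.map D.act

lemma proj_eq_iff {p q : ℍ × ℍ} :
    D.proj Γ p = D.proj Γ q ↔ ∃ γ ∈ Γ, D.act γ q = p := by
  rw [proj, proj, Quotient.eq, MulAction.orbitRel_apply]
  constructor
  · rintro ⟨⟨_, γ, hγ, rfl⟩, h⟩
    exact ⟨γ, hγ, h⟩
  · rintro ⟨γ, hγ, h⟩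
    exact ⟨⟨D.act γ, γ, hγ, rfl⟩, h⟩

lemma proj_act {γ : ProjUnits k A} (hγ : γ ∈ Γ) (p : ℍ × ℍ) :
    D.proj Γ (D.act γ p) = D.proj Γ p :=
  D.proj_eq_iff.2 ⟨γ, hγ, rfl⟩

lemma proj_surjective : Function.Surjective (D.proj Γ) := Quotient.mk_surjective

instance : ContinuousConstSMul (D.deckGroup Γ) (ℍ × ℍ) :=
  ⟨by rintro ⟨_, γ, hγ, rfl⟩; exact D.continuous_act γ⟩

namespace IsSmoothShimuraGroup

variable {D} (hΓ : D.IsSmoothShimuraGroup Γ) [NumberField k] [NumberField.IsTotallyReal k]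
  (hA : Module.finrank k A = 4)
include hΓ hA

lemma properlyDiscontinuous_deckGroup : ProperlyDiscontinuousSMul (D.deckGroup Γ) (ℍ × ℍ) := by
  let := D.mulAction
  have h := hΓ.properlyDiscontinuous hA
  refine ⟨fun {K L} hK hL => ?_⟩
  let f : Γ → D.deckGroup Γ := fun γ => ⟨D.act γ, γ, γ.2, rfl⟩
  refine ((h.finite_disjoint_inter_image hK hL).image f).subset ?_
  rintro ⟨_, γ, hγ, rfl⟩ hne
  exact ⟨⟨γ, hγ⟩, hne, rfl⟩

lemma isCancelSMul_deckGroup : IsCancelSMul (D.deckGroup Γ) (ℍ × ℍ) := by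
  rw [isCancelSMul_iff_eq_one_of_smul_eq]
  rintro ⟨_, γ, hγ, rfl⟩ p hp
  have h1 := hΓ.eq_one_of_fixed hA hγ hp
  exact Subtype.ext ((congrArg D.act h1).trans (map_one _))

lemma isQuotientCoveringMap_proj : IsQuotientCoveringMap (D.proj Γ) (D.deckGroup Γ) :=
  have := hΓ.properlyDiscontinuous_deckGroup hA
  have := hΓ.isCancelSMul_deckGroup hA
  isQuotientCoveringMap_quotientMk_of_properlyDiscontinuousSMul

lemma t2Space : T2Space (D.Surface Γ) :=
  have := hΓ.properlyDiscontinuous_deckGroup hA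
  t2Space_of_properlyDiscontinuousSMul_of_t2Space

lemma compactSpace : CompactSpace (D.Surface Γ) := by
  obtain ⟨K, hK, hcov⟩ := hΓ.exists_compact hA
  have hcont := (hΓ.isQuotientCoveringMap_proj hA).continuous
  refine ⟨?_⟩
  have : (Set.univ : Set (D.Surface Γ)) = D.proj Γ '' K := by
    refine (Set.eq_univ_of_forall fun x => ?_).symm
    obtain ⟨p, rfl⟩ := D.proj_surjective x
    obtain ⟨γ, hγ, h⟩ := hcov p
    exact ⟨_, h, D.proj_act hγ p⟩
  rw [this]
  exact hK.image hcont

end IsSmoothShimuraGroup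

end TwoPlaceSplitting

end Surfaces

/-! ### Schwarz lemma and automorphisms of the bidisc -/

section Bidisc

open Metric

/-- Equality in the Schwarz lemma on one line through the origin of the bidisc. -/
lemma eq_mul_of_norm_eq_on_axis {h : ℂ × ℂ → ℂ} (hd : DifferentiableOn ℂ h (ball 0 1))
    (hm : Set.MapsTo h (ball 0 1) (closedBall 0 1)) (h0 : h 0 = 0) {r : ℂ} (hr0 : r ≠ 0)
    (hr1 : ‖r‖ < 1) (hr : ‖h (r, 0)‖ = ‖r‖) :
    ∃ a : ℂ, ∀ v ∈ ball (0 : ℂ × ℂ) 1, h v = a * v.1 := by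
  have hline : ∀ v : ℂ × ℂ, ‖v‖ ≤ 1 →
      DifferentiableOn ℂ (fun t : ℂ => h (t • v)) (ball 0 1) ∧
      Set.MapsTo (fun t : ℂ => h (t • v)) (ball 0 1) (closedBall (h ((0 : ℂ) • v)) 1) := by
    intro v hv
    have hmaps : Set.MapsTo (fun t : ℂ => t • v) (ball 0 1) (ball 0 1) := by
      intro t ht
      rw [mem_ball_zero_iff] at ht ⊢
      rw [norm_smul]
      exact (mul_le_of_le_one_right (norm_nonneg t) hv).trans_lt ht
    refine ⟨hd.comp (by fun_prop) hmaps, ?_⟩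
    rw [zero_smul, h0]
    exact hm.comp hmaps
  have hd0 : HasFDerivAt h (fderiv ℂ h 0) 0 :=
    (hd.differentiableAt (ball_mem_nhds _ one_pos)).hasFDerivAt
  set L := fderiv ℂ h 0 with hL
  have hderiv : ∀ v : ℂ × ℂ, deriv (fun t : ℂ => h (t • v)) 0 = L v := by
    intro v
    have h1 : HasDerivAt (fun t : ℂ => t • v) v 0 := by
      simpa using (hasDerivAt_id (0 : ℂ)).smul_const v
    have h2 : HasFDerivAt h L ((0 : ℂ) • v) := by rwa [zero_smul]
    exact (h2.comp_hasDerivAt 0 h1).deriv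
  have hLle : ∀ v, ‖L v‖ ≤ ‖v‖ := by
    intro v
    have h1 : ‖L‖ ≤ 1 := Complex.norm_fderiv_le_one_of_mapsTo_ball hd (by rwa [h0]) one_pos
    simpa using L.le_of_opNorm_le h1 v
  set a := L (1, 0) with ha
  -- Equality in the one-variable Schwarz lemma on the line $w=0$.
  have ha1 : ‖a‖ = 1 := by
    obtain ⟨hd1, hm1⟩ := hline (1, 0) (by simp)
    have hds : ‖dslope (fun t : ℂ => h (t • ((1 : ℂ), (0 : ℂ)))) 0 r‖ = 1 / 1 := by
      rw [dslope_of_ne _ hr0, slope_def_module, zero_smul, h0]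
      have : ‖r‖ ≠ 0 := norm_ne_zero_iff.2 hr0
      simp [hr, this]
    obtain ⟨C, hC, hEq⟩ := Complex.affine_of_mapsTo_ball_of_exists_norm_dslope_eq_div' hd1 hm1
      ⟨r, by simpa using hr1, hds⟩
    have hev : (fun t : ℂ => h (t • ((1 : ℂ), (0 : ℂ)))) =ᶠ[nhds 0] fun t => t * C := by
      filter_upwards [ball_mem_nhds (0 : ℂ) one_pos] with t ht
      have := hEq ht
      simpa [h0] using this
    have h1 := hderiv (1, 0)
    rw [hev.deriv_eq] at h1
    have h2 : deriv (fun t : ℂ => t * C) 0 = C := by simp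
    rw [ha, ← h1, h2, hC, div_one]
  have hL2 : L (0, 1) = 0 := by
    by_contra hc
    set c := L (0, 1) with hcdef
    have hcn : (‖c‖ : ℂ) ≠ 0 := by simpa using hc
    -- The unimodular $s$ aligns the two terms of $L(1,s)=a+sc$, so $|L(1,s)|=1+|c|$, while $(1,s)$
    -- has sup norm $1$.
    set s : ℂ := a * (starRingEnd ℂ c / ‖c‖) with hs
    have hsn : ‖s‖ = 1 := by
      rw [hs, norm_mul, ha1, norm_div]
      simp [hc]
    have hLs : L (1, s) = a * (1 + ‖c‖) := by
      have : ((1 : ℂ), s) = (1, 0) + s • ((0 : ℂ), (1 : ℂ)) := by simp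
      rw [this, map_add, map_smul, ← ha, ← hcdef, smul_eq_mul, hs]
      have hcc : starRingEnd ℂ c * c = ‖c‖ * ‖c‖ := by
        rw [mul_comm, Complex.mul_conj, Complex.normSq_eq_norm_sq]
        push_cast
        ring
      have : a * (starRingEnd ℂ c / ‖c‖) * c = a * ((starRingEnd ℂ c * c) / ‖c‖) := by ring
      rw [this, hcc, mul_div_assoc, div_self hcn]
      ring
    have h1 := hLle (1, s)
    rw [hLs, norm_mul, ha1, one_mul, Prod.norm_mk, hsn, norm_one, max_self] at h1
    have h2 : ‖(1 + ‖c‖ : ℂ)‖ = 1 + ‖c‖ := by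
      rw [← Complex.ofReal_one, ← Complex.ofReal_add, Complex.norm_real, Real.norm_of_nonneg]
      positivity
    rw [h2] at h1
    have h3 : 0 < ‖c‖ := norm_pos_iff.2 hc
    linarith
  -- On the line through $(1,w/z)$ the derivative at $0$ is again $a$, of modulus $1$, so Schwarz's
  -- lemma is an equality there. The rest of the bidisc is reached by the identity theorem in $z$
  -- for fixed $w$.
  have hcone : ∀ z w : ℂ, ‖w‖ ≤ ‖z‖ → z ≠ 0 → ‖z‖ < 1 → h (z, w) = a * z := by
    intro z w hwz hz hz1
    have hz' : 0 < ‖z‖ := norm_pos_iff.2 hz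
    have hv : ‖((1 : ℂ), w / z)‖ ≤ 1 := by
      rw [Prod.norm_mk, norm_one, norm_div]
      exact max_le le_rfl ((div_le_one hz').2 hwz)
    obtain ⟨hd1, hm1⟩ := hline _ hv
    have hLv : L (1, w / z) = a := by
      have : ((1 : ℂ), w / z) = (1, 0) + (w / z) • ((0 : ℂ), (1 : ℂ)) := by simp
      rw [this, map_add, map_smul, hL2, smul_zero, add_zero]
    have hds : dslope (fun t : ℂ => h (t • ((1 : ℂ), w / z))) 0 0 = a := by
      rw [dslope_same, hderiv, hLv]
    have hEq := Complex.affine_of_mapsTo_ball_of_norm_dslope_eq_div hd1 hm1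
      (z₀ := 0) (by simp) (by rw [hds, ha1, div_one])
    have := hEq (show z ∈ ball (0 : ℂ) 1 by simpa using hz1)
    rw [hds] at this
    simpa [h0, hz, mul_div_cancel₀, mul_comm] using this
  refine ⟨a, ?_⟩
  rintro ⟨z, w⟩ hv
  rw [mem_ball_zero_iff, Prod.norm_mk, max_lt_iff] at hv
  obtain ⟨ρ, hρ1, hρ2⟩ := exists_between hv.2
  have hρ0 : 0 < ρ := (norm_nonneg w).trans_lt hρ1
  have han : AnalyticOnNhd ℂ (fun ζ : ℂ => h (ζ, w)) (ball 0 1) := by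
    refine DifferentiableOn.analyticOnNhd (hd.comp (by fun_prop) ?_) isOpen_ball
    intro ζ hζ
    rw [mem_ball_zero_iff] at hζ ⊢
    rw [Prod.norm_mk]
    exact max_lt hζ hv.2
  have han2 : AnalyticOnNhd ℂ (fun ζ : ℂ => a * ζ) (ball 0 1) :=
    DifferentiableOn.analyticOnNhd (by fun_prop) isOpen_ball
  have hρn : ‖(ρ : ℂ)‖ = ρ := by simp [abs_of_pos hρ0]
  have hev : (fun ζ : ℂ => h (ζ, w)) =ᶠ[nhds (ρ : ℂ)] fun ζ => a * ζ := by
    have h1 : ∀ᶠ ζ : ℂ in nhds (ρ : ℂ), ‖w‖ < ‖ζ‖ :=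
      (continuous_norm.continuousAt).eventually (lt_mem_nhds (hρ1.trans_eq hρn.symm))
    have h2 : ∀ᶠ ζ : ℂ in nhds (ρ : ℂ), ‖ζ‖ < 1 :=
      (continuous_norm.continuousAt).eventually (gt_mem_nhds (hρn.trans_lt hρ2))
    filter_upwards [h1, h2] with ζ hζ1 hζ2
    exact hcone ζ w hζ1.le (norm_pos_iff.1 ((norm_nonneg w).trans_lt hζ1)) hζ2
  exact han.eqOn_of_preconnected_of_eventuallyEq han2 (convex_ball 0 1).isPreconnected
    (by simpa [abs_of_pos hρ0] using hρ2) hev (by simpa using hv.1)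

/-- An automorphism of the bidisc that fixes the origin is monomial. -/
theorem monomial_of_bidisc_automorphism {F G : ℂ × ℂ → ℂ × ℂ}
    (hF : DifferentiableOn ℂ F (ball 0 1)) (hG : DifferentiableOn ℂ G (ball 0 1))
    (hFm : Set.MapsTo F (ball 0 1) (ball 0 1)) (hGm : Set.MapsTo G (ball 0 1) (ball 0 1))
    (hF0 : F 0 = 0) (hG0 : G 0 = 0) (hGF : ∀ v ∈ ball (0 : ℂ × ℂ) 1, G (F v) = v) :
    ∃ a b : ℂ, (∀ v ∈ ball (0 : ℂ × ℂ) 1, F v = (a * v.1, b * v.2)) ∨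
      (∀ v ∈ ball (0 : ℂ × ℂ) 1, F v = (a * v.2, b * v.1)) := by
  -- The Schwarz lemma for both $F$ and its inverse.
  have hnorm : ∀ v : ℂ × ℂ, ‖v‖ < 1 → ‖F v‖ = ‖v‖ := by
    intro v hv
    have hv' : v ∈ ball (0 : ℂ × ℂ) 1 := mem_ball_zero_iff.2 hv
    refine le_antisymm (Complex.norm_le_norm_of_mapsTo_ball hF
      (hFm.mono_right ball_subset_closedBall) hF0 hv) ?_
    have := Complex.norm_le_norm_of_mapsTo_ball hG
      (hGm.mono_right ball_subset_closedBall) hG0 (mem_ball_zero_iff.1 (hFm hv'))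
    rwa [hGF v hv'] at this
  have hsw : Set.MapsTo (Prod.swap : ℂ × ℂ → ℂ × ℂ) (ball 0 1) (ball 0 1) := by
    rintro ⟨z, w⟩ hv
    rw [mem_ball_zero_iff, Prod.norm_mk] at hv
    rw [mem_ball_zero_iff, Prod.swap_prod_mk, Prod.norm_mk, max_comm]
    exact hv
  have hswd : DifferentiableOn ℂ (Prod.swap : ℂ × ℂ → ℂ × ℂ) (ball 0 1) :=
    (differentiable_snd.prodMk differentiable_fst).differentiableOn
  have hsw0 : (Prod.swap (0 : ℂ × ℂ)) = 0 := rfl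
  have hd1 : DifferentiableOn ℂ (fun v => (F v).1) (ball 0 1) := hF.fst
  have hd2 : DifferentiableOn ℂ (fun v => (F v).2) (ball 0 1) := hF.snd
  have hm1 : Set.MapsTo (fun v => (F v).1) (ball 0 1) (closedBall 0 1) := fun v hv =>
    mem_closedBall_zero_iff.2 ((norm_fst_le _).trans (mem_ball_zero_iff.1 (hFm hv)).le)
  have hm2 : Set.MapsTo (fun v => (F v).2) (ball 0 1) (closedBall 0 1) := fun v hv =>
    mem_closedBall_zero_iff.2 ((norm_snd_le _).trans (mem_ball_zero_iff.1 (hFm hv)).le)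
  have hr0 : (2⁻¹ : ℂ) ≠ 0 := by norm_num
  have hr1 : ‖(2⁻¹ : ℂ)‖ < 1 := by norm_num
  have hb1 : ‖((2⁻¹ : ℂ), (0 : ℂ))‖ < 1 := by rw [Prod.norm_mk]; simp; norm_num
  have hb2 : ‖((0 : ℂ), (2⁻¹ : ℂ))‖ < 1 := by rw [Prod.norm_mk]; simp; norm_num
  have hn1 := hnorm _ hb1
  have hn2 := hnorm _ hb2
  have he1 : ‖((2⁻¹ : ℂ), (0 : ℂ))‖ = ‖(2⁻¹ : ℂ)‖ := by rw [Prod.norm_mk]; simp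
  have he2 : ‖((0 : ℂ), (2⁻¹ : ℂ))‖ = ‖(2⁻¹ : ℂ)‖ := by rw [Prod.norm_mk]; simp
  rw [he1, Prod.norm_def] at hn1
  rw [he2, Prod.norm_def] at hn2
  -- Some component attains the norm at $(1/2,0)$, hence is a multiple of $z$. It vanishes at
  -- $(0,1/2)$, so there the other component attains the norm and is a multiple of $w$.
  rcases max_choice ‖(F (2⁻¹, 0)).1‖ ‖(F (2⁻¹, 0)).2‖ with hc | hc
  · rw [hc] at hn1
    obtain ⟨a, ha⟩ := eq_mul_of_norm_eq_on_axis hd1 hm1 (by simp [hF0]) hr0 hr1 hn1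
    have hz := ha (0, 2⁻¹) (mem_ball_zero_iff.2 hb2)
    rw [mul_zero] at hz
    rw [hz, norm_zero, max_eq_right (norm_nonneg _)] at hn2
    obtain ⟨b, hb⟩ := eq_mul_of_norm_eq_on_axis (hd2.comp hswd hsw) (hm2.comp hsw)
      (by simp [hF0, hsw0]) hr0 hr1 hn2
    refine ⟨a, b, Or.inl fun v hv => Prod.ext (ha v hv) ?_⟩
    simpa using hb v.swap (hsw hv)
  · rw [hc] at hn1
    obtain ⟨b, hb⟩ := eq_mul_of_norm_eq_on_axis hd2 hm2 (by simp [hF0]) hr0 hr1 hn1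
    have hz := hb (0, 2⁻¹) (mem_ball_zero_iff.2 hb2)
    rw [mul_zero] at hz
    rw [hz, norm_zero, max_eq_left (norm_nonneg _)] at hn2
    obtain ⟨a, ha⟩ := eq_mul_of_norm_eq_on_axis (hd1.comp hswd hsw) (hm1.comp hsw)
      (by simp [hF0, hsw0]) hr0 hr1 hn2
    refine ⟨a, b, Or.inr fun v hv => Prod.ext ?_ (hb v hv)⟩
    simpa using ha v.swap (hsw hv)

end Bidisc

/-! ### Automorphisms of $\mathbb{H}\times\mathbb{H}$ in Cayley coordinates -/

section Cayley

open UpperHalfPlane Metric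

/-- The Cayley transform with centre `q`. -/
def cayley (q z : ℍ) : ℂ := (z - q) / (z - starRingEnd ℂ q)

/-- The inverse of the Cayley transform with centre `q`. -/
def invCayley (q : ℍ) (w : ℂ) : ℍ := ofComplex ((q - starRingEnd ℂ q * w) / (1 - w))

lemma sub_conj_ne_zero (q z : ℍ) : (z : ℂ) - starRingEnd ℂ q ≠ 0 := by
  intro h
  have := congrArg Complex.im h
  simp at this
  linarith [z.im_pos, q.im_pos]

lemma cayley_self (q : ℍ) : cayley q q = 0 := by simp [cayley]

lemma norm_cayley_lt_one (q z : ℍ) : ‖cayley q z‖ < 1 := by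
  rw [cayley, norm_div, div_lt_one (norm_pos_iff.2 (sub_conj_ne_zero q z))]
  refine lt_of_pow_lt_pow_left₀ 2 (norm_nonneg _) ?_
  rw [← Complex.normSq_eq_norm_sq, ← Complex.normSq_eq_norm_sq, Complex.normSq_apply,
    Complex.normSq_apply]
  simp
  nlinarith [mul_pos z.im_pos q.im_pos]

lemma im_invCayley_pos (q : ℍ) {w : ℂ} (hw : ‖w‖ < 1) :
    0 < ((q - starRingEnd ℂ q * w) / (1 - w) : ℂ).im := by
  have hsq : Complex.normSq w < 1 := by
    rw [Complex.normSq_eq_norm_sq]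
    nlinarith [norm_nonneg w]
  have hw1 : (1 - w) ≠ 0 := by
    intro h
    rw [← sub_eq_zero.1 h] at hw
    simp at hw
  have hpos : 0 < Complex.normSq (1 - w) := Complex.normSq_pos.2 hw1
  have : ((q - starRingEnd ℂ q * w) / (1 - w) : ℂ).im =
      q.im * (1 - Complex.normSq w) / Complex.normSq (1 - w) := by
    rw [Complex.div_im, ← sub_div]
    congr 1
    simp [Complex.normSq_apply]
    ring
  rw [this]
  exact div_pos (mul_pos q.im_pos (by linarith)) hpos

lemma one_sub_ne_zero_of_norm_lt {w : ℂ} (hw : ‖w‖ < 1) : 1 - w ≠ 0 := by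
  intro h
  rw [← sub_eq_zero.1 h] at hw
  simp at hw

lemma coe_invCayley (q : ℍ) {w : ℂ} (hw : ‖w‖ < 1) :
    (invCayley q w : ℂ) = (q - starRingEnd ℂ q * w) / (1 - w) := by
  rw [invCayley, ofComplex_apply_of_im_pos (im_invCayley_pos q hw)]

lemma cayley_invCayley (q : ℍ) {w : ℂ} (hw : ‖w‖ < 1) : cayley q (invCayley q w) = w := by
  have h1 := one_sub_ne_zero_of_norm_lt hw
  have h2 := sub_conj_ne_zero q (invCayley q w)
  have h3 := sub_conj_ne_zero q q
  rw [cayley, div_eq_iff h2, coe_invCayley q hw]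
  field_simp
  ring

lemma cayley_injective (q : ℍ) : Function.Injective (cayley q) := by
  intro z w h
  have h1 := sub_conj_ne_zero q z
  have h2 := sub_conj_ne_zero q w
  have h3 := sub_conj_ne_zero q q
  rw [cayley, cayley, div_eq_div_iff h1 h2] at h
  have : ((z : ℂ) - w) * (q - starRingEnd ℂ q) = 0 := by linear_combination h
  exact UpperHalfPlane.ext (sub_eq_zero.1 ((mul_eq_zero.1 this).resolve_right h3))

lemma invCayley_cayley (q z : ℍ) : invCayley q (cayley q z) = z :=
  cayley_injective q (cayley_invCayley q (norm_cayley_lt_one q z))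

lemma invCayley_zero (q : ℍ) : invCayley q 0 = q := by
  rw [← cayley_self q, invCayley_cayley]

lemma cayley_eq_zero_iff {q z : ℍ} : cayley q z = 0 ↔ z = q :=
  ⟨fun h => cayley_injective q (h.trans (cayley_self q).symm), fun h => h ▸ cayley_self q⟩

lemma mdifferentiable_cayley (q : ℍ) : MDifferentiable 𝓘(ℂ) 𝓘(ℂ) (cayley q) := by
  intro z
  rw [mdifferentiableAt_iff]
  have h : (cayley q ∘ ofComplex) =ᶠ[nhds (z : ℂ)]
      fun t => (t - q) / (t - starRingEnd ℂ q) := by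
    filter_upwards [eventuallyEq_coe_comp_ofComplex z.im_pos] with t ht
    simp only [Function.comp_apply, id] at ht
    simp [cayley, ht]
  refine DifferentiableAt.congr_of_eventuallyEq ?_ h
  exact DifferentiableAt.div (by fun_prop) (by fun_prop) (sub_conj_ne_zero q z)

lemma mdifferentiableAt_invCayley (q : ℍ) {w : ℂ} (hw : ‖w‖ < 1) :
    MDifferentiableAt 𝓘(ℂ) 𝓘(ℂ) (invCayley q) w := by
  refine (mdifferentiableAt_ofComplex (im_invCayley_pos q hw)).comp w ?_
  rw [mdifferentiableAt_iff_differentiableAt]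
  exact DifferentiableAt.div (by fun_prop) (by fun_prop) (one_sub_ne_zero_of_norm_lt hw)

/-- The expression of a self-map of `ℍ × ℍ` in Cayley coordinates. -/
def cayleyConj (p q : ℍ × ℍ) (f : ℍ × ℍ → ℍ × ℍ) (v : ℂ × ℂ) : ℂ × ℂ :=
  (cayley q.1 (f (invCayley p.1 v.1, invCayley p.2 v.2)).1,
    cayley q.2 (f (invCayley p.1 v.1, invCayley p.2 v.2)).2)

lemma norm_fst_snd_lt {v : ℂ × ℂ} (hv : v ∈ ball (0 : ℂ × ℂ) 1) : ‖v.1‖ < 1 ∧ ‖v.2‖ < 1 := by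
  rw [mem_ball_zero_iff] at hv
  exact ⟨(norm_fst_le v).trans_lt hv, (norm_snd_le v).trans_lt hv⟩

lemma cayleyConj_mapsTo (p q : ℍ × ℍ) (f : ℍ × ℍ → ℍ × ℍ) (s : Set (ℂ × ℂ)) :
    Set.MapsTo (cayleyConj p q f) s (ball 0 1) := fun v _ => by
  rw [mem_ball_zero_iff, Prod.norm_def]
  exact max_lt (norm_cayley_lt_one _ _) (norm_cayley_lt_one _ _)

lemma differentiableOn_cayleyConj (p q : ℍ × ℍ) {f : ℍ × ℍ → ℍ × ℍ}
    (hf : MDifferentiable (𝓘(ℂ).prod 𝓘(ℂ)) (𝓘(ℂ).prod 𝓘(ℂ)) f) :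
    DifferentiableOn ℂ (cayleyConj p q f) (ball 0 1) := by
  intro v hv
  obtain ⟨hv1, hv2⟩ := norm_fst_snd_lt hv
  have hfst : MDifferentiableAt 𝓘(ℂ, ℂ × ℂ) 𝓘(ℂ) (Prod.fst : ℂ × ℂ → ℂ) v :=
    mdifferentiableAt_iff_differentiableAt.2 differentiableAt_fst
  have hsnd : MDifferentiableAt 𝓘(ℂ, ℂ × ℂ) 𝓘(ℂ) (Prod.snd : ℂ × ℂ → ℂ) v :=
    mdifferentiableAt_iff_differentiableAt.2 differentiableAt_snd
  have hinv : MDifferentiableAt 𝓘(ℂ, ℂ × ℂ) (𝓘(ℂ).prod 𝓘(ℂ))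
      (fun v : ℂ × ℂ => (invCayley p.1 v.1, invCayley p.2 v.2)) v :=
    ((mdifferentiableAt_invCayley p.1 hv1).comp v hfst).prodMk
      ((mdifferentiableAt_invCayley p.2 hv2).comp v hsnd)
  have hfi := (hf (invCayley p.1 v.1, invCayley p.2 v.2)).comp v hinv
  have h1 : DifferentiableAt ℂ (fun v => (cayleyConj p q f v).1) v :=
    mdifferentiableAt_iff_differentiableAt.1
      ((mdifferentiable_cayley q.1 _).comp v (mdifferentiableAt_fst.comp v hfi))
  have h2 : DifferentiableAt ℂ (fun v => (cayleyConj p q f v).2) v :=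
    mdifferentiableAt_iff_differentiableAt.1
      ((mdifferentiable_cayley q.2 _).comp v (mdifferentiableAt_snd.comp v hfi))
  exact (h1.prodMk h2).differentiableWithinAt

/-- Automorphisms of `ℍ × ℍ` preserve or exchange the factors, and are linear in Cayley
coordinates. -/
theorem IsBiholomorphicBidisc.cayley_linear {f : (ℍ × ℍ) ≃ₜ (ℍ × ℍ)} (hf : IsBiholomorphicBidisc f)
    (p : ℍ × ℍ) : ∃ a b : ℂ,
      (∀ x, cayley (f p).1 (f x).1 = a * cayley p.1 x.1 ∧
        cayley (f p).2 (f x).2 = b * cayley p.2 x.2) ∨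
      (∀ x, cayley (f p).1 (f x).1 = a * cayley p.2 x.2 ∧
        cayley (f p).2 (f x).2 = b * cayley p.1 x.1) := by
  set q := f p with hq
  have hqp : f.symm q = p := f.symm_apply_apply p
  have hx : ∀ x : ℍ × ℍ, (cayley p.1 x.1, cayley p.2 x.2) ∈ ball (0 : ℂ × ℂ) 1 := by
    intro x
    rw [mem_ball_zero_iff, Prod.norm_def]
    exact max_lt (norm_cayley_lt_one _ _) (norm_cayley_lt_one _ _)
  have hFx : ∀ x, cayleyConj p q f (cayley p.1 x.1, cayley p.2 x.2) =
      (cayley q.1 (f x).1, cayley q.2 (f x).2) := by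
    intro x
    simp [cayleyConj, invCayley_cayley]
  obtain ⟨a, b, h⟩ := monomial_of_bidisc_automorphism (differentiableOn_cayleyConj p q hf.1)
    (differentiableOn_cayleyConj q p hf.2) (cayleyConj_mapsTo p q f _)
    (cayleyConj_mapsTo q p f.symm _)
    (by simp [cayleyConj, invCayley_zero, ← hq, cayley_self])
    (by simp [cayleyConj, invCayley_zero, hqp, cayley_self])
    (by
      intro v hv
      obtain ⟨hv1, hv2⟩ := norm_fst_snd_lt hv
      simp [cayleyConj, invCayley_cayley, cayley_invCayley, hv1, hv2])
  refine ⟨a, b, h.imp (fun h x => ?_) (fun h x => ?_)⟩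
  all_goals
    have := h _ (hx x)
    rw [hFx] at this
    exact ⟨congrArg Prod.fst this, congrArg Prod.snd this⟩

end Cayley

/-! ### Lifting automorphisms of $X$ -/

section Lifting

open UpperHalfPlane Topology

variable {k : Type*} [Field k] {A : Type*} [DivisionRing A] [Algebra k A]
  {D : TwoPlaceSplitting k A} {Γ : Subgroup (ProjUnits k A)}

lemma mdifferentiable_prod_of_coe {f : ℍ × ℍ → ℍ × ℍ}
    (h₁ : MDifferentiable (𝓘(ℂ).prod 𝓘(ℂ)) 𝓘(ℂ) (fun x => ((f x).1 : ℂ)))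
    (h₂ : MDifferentiable (𝓘(ℂ).prod 𝓘(ℂ)) 𝓘(ℂ) (fun x => ((f x).2 : ℂ))) :
    MDifferentiable (𝓘(ℂ).prod 𝓘(ℂ)) (𝓘(ℂ).prod 𝓘(ℂ)) f := by
  intro x
  have e₁ : (fun x => (f x).1) = ofComplex ∘ fun x => ((f x).1 : ℂ) := by
    funext x; exact (ofComplex_apply _).symm
  have e₂ : (fun x => (f x).2) = ofComplex ∘ fun x => ((f x).2 : ℂ) := by
    funext x; exact (ofComplex_apply _).symm
  have d₁ : MDifferentiableAt (𝓘(ℂ).prod 𝓘(ℂ)) 𝓘(ℂ) (fun x => (f x).1) x := by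
    rw [e₁]
    exact (mdifferentiableAt_ofComplex (f x).1.im_pos).comp x (h₁ x)
  have d₂ : MDifferentiableAt (𝓘(ℂ).prod 𝓘(ℂ)) 𝓘(ℂ) (fun x => (f x).2) x := by
    rw [e₂]
    exact (mdifferentiableAt_ofComplex (f x).2.im_pos).comp x (h₂ x)
  exact d₁.prodMk d₂

lemma TwoPlaceSplitting.act_fst_congr (D : TwoPlaceSplitting k A) (γ : ProjUnits k A) {x y : ℍ × ℍ} (h : x.1 = y.1) :
    (D.act γ x).1 = (D.act γ y).1 := by
  obtain ⟨u, rfl⟩ := QuotientGroup.mk'_surjective _ γ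
  rw [D.act_mk, D.act_mk, h]

lemma TwoPlaceSplitting.act_snd_congr (D : TwoPlaceSplitting k A) (γ : ProjUnits k A) {x y : ℍ × ℍ} (h : x.2 = y.2) :
    (D.act γ x).2 = (D.act γ y).2 := by
  obtain ⟨u, rfl⟩ := QuotientGroup.mk'_surjective _ γ
  rw [D.act_mk, D.act_mk, h]

namespace TwoPlaceSplitting.IsSmoothShimuraGroup

section

variable (hΓ : D.IsSmoothShimuraGroup Γ)
include hΓ

lemma mdifferentiable_act {γ : ProjUnits k A} (hγ : γ ∈ Γ) :
    MDifferentiable (𝓘(ℂ).prod 𝓘(ℂ)) (𝓘(ℂ).prod 𝓘(ℂ)) (D.act γ) := by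
  obtain ⟨u, rfl, h₁, h₂⟩ := hΓ.exists_unit hγ
  intro x
  exact ((mdifferentiable_smul h₁ x.1).comp x mdifferentiableAt_fst).prodMk
    ((mdifferentiable_smul h₂ x.2).comp x mdifferentiableAt_snd)

/-- Holomorphic functions on an evenly covered open set descend to the surface. -/
lemma exists_descent {N : Set (ℍ × ℍ)} (hN : IsOpen N) (hinj : Set.InjOn (D.proj Γ) N)
    {c : ℍ × ℍ → ℂ} (hc : MDifferentiable (𝓘(ℂ).prod 𝓘(ℂ)) 𝓘(ℂ) c) :
    ∃ g : D.Surface Γ → ℂ, IsHolomorphicOn (D.proj Γ '' N) g ∧ ∀ x ∈ N, g (D.proj Γ x) = c x := by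
  classical
  let g : D.Surface Γ → ℂ := fun y =>
    if h : ∃ x ∈ N, D.proj Γ x = y then c h.choose else 0
  have hg : ∀ x ∈ N, g (D.proj Γ x) = c x := by
    intro x hx
    have h : ∃ x' ∈ N, D.proj Γ x' = D.proj Γ x := ⟨x, hx, rfl⟩
    simp only [g, dif_pos h]
    rw [hinj h.choose_spec.1 hx h.choose_spec.2]
  refine ⟨g, ?_, hg⟩
  rintro r ⟨n, hn, hnr⟩
  -- The point $r$ need not lie in $N$, but a translate $\gamma r$ does; near $r$ the pullback of
  -- $g$ is $c\circ\gamma$.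
  obtain ⟨γ, hγ, h⟩ := D.proj_eq_iff.1 hnr
  refine MDifferentiableAt.mdifferentiableWithinAt ?_
  have hd : MDifferentiableAt (𝓘(ℂ).prod 𝓘(ℂ)) 𝓘(ℂ) (c ∘ D.act γ) r :=
    (hc (D.act γ r)).comp r (hΓ.mdifferentiable_act hγ r)
  refine hd.congr_of_eventuallyEq ?_
  have hmem : ∀ᶠ x in 𝓝 r, D.act γ x ∈ N :=
    (D.continuous_act γ).continuousAt.eventually (hN.mem_nhds (by rwa [h]))
  filter_upwards [hmem] with x hx
  rw [Function.comp_apply, Function.comp_apply, ← hg _ hx, D.proj_act hγ]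

end

variable (hΓ : D.IsSmoothShimuraGroup Γ) [NumberField k] [NumberField.IsTotallyReal k]
  (hA : Module.finrank k A = 4)
include hΓ hA

lemma continuous_proj : Continuous (D.proj Γ) := (hΓ.isQuotientCoveringMap_proj hA).continuous

lemma isOpenMap_proj : IsOpenMap (D.proj Γ) :=
  (hΓ.isQuotientCoveringMap_proj hA).isOpenQuotientMap.isOpenMap

/-- Lifts of the identity of `X_Γ` are elements of `Γ`. -/
lemma exists_deck {h : ℍ × ℍ → ℍ × ℍ} (hc : Continuous h) (hh : ∀ x, D.proj Γ (h x) = D.proj Γ x) :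
    ∃ γ ∈ Γ, ∀ x, h x = D.act γ x := by
  obtain ⟨γ, hγ, hγx⟩ := D.proj_eq_iff.1 (hh (I, I))
  refine ⟨γ, hγ, fun x => ?_⟩
  refine congrFun ((hΓ.isQuotientCoveringMap_proj hA).isCoveringMap.eq_of_comp_eq hc
    (D.continuous_act γ) ?_ (I, I) hγx.symm) x
  funext y
  rw [Function.comp_apply, Function.comp_apply, hh, D.proj_act hγ]

lemma eq_id_of_lift {h : ℍ × ℍ → ℍ × ℍ} (hc : Continuous h)
    (hh : ∀ x, D.proj Γ (h x) = D.proj Γ x) {p : ℍ × ℍ} (hp : h p = p) (x : ℍ × ℍ) : h x = x := by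
  obtain ⟨γ, hγ, hγx⟩ := hΓ.exists_deck hA hc hh
  have := hΓ.eq_one_of_fixed hA hγ ((hγx p).symm.trans hp)
  rw [hγx, this, map_one]
  rfl

/-- Homeomorphisms of `X_Γ` lift to `ℍ × ℍ`. -/
theorem exists_lift (σ : D.Surface Γ ≃ₜ D.Surface Γ) {p q : ℍ × ℍ}
    (hpq : σ (D.proj Γ p) = D.proj Γ q) :
    ∃ f : (ℍ × ℍ) ≃ₜ (ℍ × ℍ), f p = q ∧ ∀ x, D.proj Γ (f x) = σ (D.proj Γ x) := by
  have hcov := (hΓ.isQuotientCoveringMap_proj hA).isCoveringMap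
  have hpc := hΓ.continuous_proj hA
  -- Lifts of $\sigma$ and $\sigma^{-1}$ with interchanged base points. Their composites lift the
  -- identity and fix a point, so they are trivial.
  obtain ⟨F, ⟨hFp, hF⟩, -⟩ := hcov.existsUnique_continuousMap_lifts
    (⟨fun x => σ (D.proj Γ x), σ.continuous.comp hpc⟩ : C(ℍ × ℍ, D.Surface Γ)) p q hpq.symm
  obtain ⟨G, ⟨hGq, hG⟩, -⟩ := hcov.existsUnique_continuousMap_lifts
    (⟨fun x => σ.symm (D.proj Γ x), σ.symm.continuous.comp hpc⟩ : C(ℍ × ℍ, D.Surface Γ)) q p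
    (by simp [← hpq])
  have hF' : ∀ x, D.proj Γ (F x) = σ (D.proj Γ x) := fun x => congrFun hF x
  have hG' : ∀ x, D.proj Γ (G x) = σ.symm (D.proj Γ x) := fun x => congrFun hG x
  refine ⟨⟨⟨F, G, fun x => ?_, fun x => ?_⟩, F.continuous, G.continuous⟩, hFp, hF'⟩
  · exact hΓ.eq_id_of_lift hA (G.continuous.comp F.continuous)
      (fun x => by rw [Function.comp_apply, hG', hF', Homeomorph.symm_apply_apply])
      (p := p) (by simp [hFp, hGq]) x
  · exact hΓ.eq_id_of_lift hA (F.continuous.comp G.continuous)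
      (fun x => by rw [Function.comp_apply, hF', hG', Homeomorph.apply_symm_apply])
      (p := q) (by simp [hFp, hGq]) x

lemma exists_injOn_nhds (p : ℍ × ℍ) : ∃ N : Set (ℍ × ℍ), IsOpen N ∧ p ∈ N ∧
    Set.InjOn (D.proj Γ) N := by
  obtain ⟨U, hU, hdisj⟩ := (hΓ.isQuotientCoveringMap_proj hA).disjoint p
  refine ⟨interior U, isOpen_interior, mem_interior_iff_mem_nhds.2 hU, fun x hx y hy hxy => ?_⟩
  obtain ⟨γ, hγ, h⟩ := D.proj_eq_iff.1 hxy
  have h1 := hdisj ⟨D.act γ, γ, hγ, rfl⟩ ⟨x, ⟨y, interior_subset hy, h⟩, interior_subset hx⟩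
  have h2 : D.act γ = 1 := congrArg Subtype.val h1
  rw [← h, h2]
  rfl

/-- Holomorphy on $X$ is tested on functions: locally $c$ descends to $g$, and $c\circ f$ is the
pullback of $g\circ\sigma$. -/
lemma mdifferentiable_lift_comp {σ : D.Surface Γ → D.Surface Γ} (hσ : IsHolomorphicMap σ)
    {f : ℍ × ℍ → ℍ × ℍ} (hfc : Continuous f) (hf : ∀ x, D.proj Γ (f x) = σ (D.proj Γ x))
    {c : ℍ × ℍ → ℂ} (hc : MDifferentiable (𝓘(ℂ).prod 𝓘(ℂ)) 𝓘(ℂ) c) :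
    MDifferentiable (𝓘(ℂ).prod 𝓘(ℂ)) 𝓘(ℂ) (c ∘ f) := by
  intro x
  obtain ⟨N, hN, hxN, hinj⟩ := hΓ.exists_injOn_nhds hA (f x)
  obtain ⟨g, hg, hgc⟩ := hΓ.exists_descent hN hinj hc
  have hopen := hΓ.isOpenMap_proj hA N hN
  have h1 := hσ.2 _ g hopen hg
  have hUo : IsOpen (D.proj Γ ⁻¹' (σ ⁻¹' (D.proj Γ '' N))) :=
    (hopen.preimage hσ.1).preimage (hΓ.continuous_proj hA)
  have hxU : x ∈ D.proj Γ ⁻¹' (σ ⁻¹' (D.proj Γ '' N)) := ⟨f x, hxN, hf x⟩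
  have h2 := MDifferentiableOn.mdifferentiableAt h1 (hUo.mem_nhds hxU)
  refine h2.congr_of_eventuallyEq ?_
  filter_upwards [hfc.continuousAt.eventually (hN.mem_nhds hxN)] with y hy
  rw [Function.comp_apply, ← hgc _ hy, hf]
  rfl

lemma mdifferentiable_lift {σ : D.Surface Γ → D.Surface Γ} (hσ : IsHolomorphicMap σ)
    {f : ℍ × ℍ → ℍ × ℍ} (hfc : Continuous f) (hf : ∀ x, D.proj Γ (f x) = σ (D.proj Γ x)) :
    MDifferentiable (𝓘(ℂ).prod 𝓘(ℂ)) (𝓘(ℂ).prod 𝓘(ℂ)) f :=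
  mdifferentiable_prod_of_coe
    (hΓ.mdifferentiable_lift_comp hA hσ hfc hf
      (c := fun x => (x.1 : ℂ)) (mdifferentiable_coe.comp mdifferentiable_fst))
    (hΓ.mdifferentiable_lift_comp hA hσ hfc hf
      (c := fun x => (x.2 : ℂ)) (mdifferentiable_coe.comp mdifferentiable_snd))

/-- Automorphisms of `X_Γ` lift to biholomorphic maps. -/
lemma isBiholomorphic_lift {σ : D.Surface Γ ≃ₜ D.Surface Γ} (hσ : IsAutomorphism σ)
    {f : (ℍ × ℍ) ≃ₜ (ℍ × ℍ)} (hf : ∀ x, D.proj Γ (f x) = σ (D.proj Γ x)) :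
    IsBiholomorphicBidisc f := by
  refine ⟨hΓ.mdifferentiable_lift hA hσ.1 f.continuous hf,
    hΓ.mdifferentiable_lift hA hσ.2 f.symm.continuous fun x => ?_⟩
  rw [Homeomorph.eq_symm_apply, ← hf, Homeomorph.apply_symm_apply]

/-- Near a fixed point the fixed points of an automorphism are those of its lift. -/
lemma exists_nhds_fixed_iff {σ : D.Surface Γ ≃ₜ D.Surface Γ} {f : (ℍ × ℍ) ≃ₜ (ℍ × ℍ)}
    (hf : ∀ x, D.proj Γ (f x) = σ (D.proj Γ x)) {p : ℍ × ℍ} (hp : f p = p) :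
    ∃ V : Set (ℍ × ℍ), IsOpen V ∧ p ∈ V ∧ Set.InjOn (D.proj Γ) V ∧
      ∀ x ∈ V, σ (D.proj Γ x) = D.proj Γ x ↔ f x = x := by
  obtain ⟨N, hN, hpN, hinj⟩ := hΓ.exists_injOn_nhds hA p
  refine ⟨N ∩ f ⁻¹' N, hN.inter (hN.preimage f.continuous), ⟨hpN, by simpa [hp] using hpN⟩,
    hinj.mono Set.inter_subset_left, fun x hx => ⟨fun h => ?_, fun h => ?_⟩⟩
  · exact hinj hx.2 hx.1 ((hf x).trans h)
  · rw [← hf, h]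

end TwoPlaceSplitting.IsSmoothShimuraGroup

end Lifting

/-! ### Fixed points of lifts -/

section FixedPoints

open UpperHalfPlane Topology

lemma dist_gl_smul {g : GL (Fin 2) ℝ} (hg : 0 < g.det.val) (z w : ℍ) :
    dist (g • z) (g • w) = dist z w := by
  set s := Real.sqrt g.det.val with hs
  have hs0 : s ≠ 0 := (Real.sqrt_pos.2 hg).ne'
  have hss : s * s = (g : Matrix (Fin 2) (Fin 2) ℝ).det := Real.mul_self_sqrt hg.le
  let h : SL(2, ℝ) := ⟨s⁻¹ • (g : Matrix (Fin 2) (Fin 2) ℝ), by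
    rw [Matrix.det_smul, ← hss, Fintype.card_fin]
    field_simp⟩
  have hgh : g = Matrix.GeneralLinearGroup.scalar (Fin 2) (Units.mk0 s hs0) *
      (h : GL (Fin 2) ℝ) := by
    ext i j
    have hh : ((h : GL (Fin 2) ℝ) : Matrix (Fin 2) (Fin 2) ℝ) = s⁻¹ • (g : Matrix _ _ ℝ) := rfl
    simp [hh, hs0]
  have key : ∀ z : ℍ, g • z = h • z := by
    intro z
    rw [sl_smul_eq_gl_smul h (h : GL (Fin 2) ℝ) rfl, hgh, mul_smul, glScalar_smul]
  rw [key, key, dist_smul]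

lemma exists_dist_gt (p : ℍ) (M : ℝ) : ∃ z : ℍ, M < dist z p := by
  set r := Real.exp (Real.log p.im + (|M| + 1)) with hr
  have him : ((r : ℂ) * Complex.I).im = r := by simp
  refine ⟨⟨r * Complex.I, by rw [him]; exact Real.exp_pos _⟩, ?_⟩
  refine lt_of_lt_of_le ?_ (dist_log_im_le _ _)
  rw [← coe_im, him, hr, Real.log_exp, Real.dist_eq, add_sub_cancel_left]
  have := le_abs_self M
  have h2 := le_abs_self (|M| + 1)
  linarith

variable {k : Type*} [Field k] {A : Type*} [DivisionRing A] [Algebra k A]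
  {D : TwoPlaceSplitting k A} {Γ : Subgroup (ProjUnits k A)}

namespace TwoPlaceSplitting.IsSmoothShimuraGroup

variable (hΓ : D.IsSmoothShimuraGroup Γ)

include hΓ in
lemma dist_act {γ : ProjUnits k A} (hγ : γ ∈ Γ) (x y : ℍ × ℍ) :
    dist (D.act γ x).1 (D.act γ y).1 = dist x.1 y.1 ∧
      dist (D.act γ x).2 (D.act γ y).2 = dist x.2 y.2 := by
  obtain ⟨u, rfl, h₁, h₂⟩ := hΓ.exists_unit hγ
  exact ⟨dist_gl_smul h₁ _ _, dist_gl_smul h₂ _ _⟩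

variable [NumberField k] [NumberField.IsTotallyReal k] (hA : Module.finrank k A = 4)
include hΓ hA

/-- `Γ` has no fixed point in either factor. The factor is given by the projection `c`. -/
lemma exists_moved {c : ℍ × ℍ → ℍ} (hc : Continuous c) (hcs : Function.Surjective c)
    (hiso : ∀ γ ∈ Γ, ∀ x y, dist (c (D.act γ x)) (c (D.act γ y)) = dist (c x) (c y)) (p : ℍ × ℍ) :
    ∃ γ ∈ Γ, c (D.act γ p) ≠ c p := by
  by_contra! hfix
  obtain ⟨K, hK, hcov⟩ := hΓ.exists_compact hA
  obtain ⟨M, hM⟩ := hK.bddAbove_image (f := fun x => dist (c x) (c p))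
    (hc.dist continuous_const).continuousOn
  obtain ⟨z, hz⟩ := exists_dist_gt (c p) M
  obtain ⟨x, rfl⟩ := hcs z
  obtain ⟨γ, hγ, hx⟩ := hcov x
  have h1 : dist (c (D.act γ x)) (c p) ≤ M := hM ⟨_, hx, rfl⟩
  rw [← hfix γ hγ, hiso γ hγ] at h1
  linarith

/-- A lift of an automorphism that is trivial on one factor and has a fixed point is trivial on the
other factor. The factors are given by the projections `c` and `c'`. -/
lemma eq_one_of_lift_trivial_on_factor {σ : D.Surface Γ ≃ₜ D.Surface Γ}
    {f : (ℍ × ℍ) ≃ₜ (ℍ × ℍ)} (hf : ∀ x, D.proj Γ (f x) = σ (D.proj Γ x)) {p : ℍ × ℍ} (hp : f p = p)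
    {c c' : ℍ × ℍ → ℍ} (hc' : Continuous c') (hcs' : Function.Surjective c')
    (hcongr : ∀ γ ∈ Γ, ∀ x y, c x = c y → c (D.act γ x) = c (D.act γ y))
    (heq : ∀ γ ∈ Γ, (∀ x, c (D.act γ x) = c x) → γ = 1)
    (hiso : ∀ γ ∈ Γ, ∀ x y, dist (c' (D.act γ x)) (c' (D.act γ y)) = dist (c' x) (c' y))
    (hcf : ∀ x, c (f x) = c x) {b : ℂ}
    (hb : ∀ x, cayley (c' p) (c' (f x)) = b * cayley (c' p) (c' x)) : b = 1 := by
  by_contra hb1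
  obtain ⟨γ, hγ, hne⟩ := hΓ.exists_moved hA hc' hcs' hiso p
  apply hne
  -- Here $\delta=f\gamma f^{-1}$. It agrees with $\gamma$ on the factor $c$, hence equals $\gamma$;
  -- so $f$ fixes $\gamma p$.
  obtain ⟨δ, hδ, hδx⟩ := hΓ.exists_deck hA (h := fun x => f (D.act γ (f.symm x)))
    (f.continuous.comp ((D.continuous_act γ).comp f.symm.continuous)) (fun x => by
      rw [hf, D.proj_act hγ, ← hf, Homeomorph.apply_symm_apply])
  have hcf' : ∀ x, c (f.symm x) = c x := fun x => by
    rw [← hcf (f.symm x), Homeomorph.apply_symm_apply]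
  have hδγ : δ * γ⁻¹ = 1 := by
    refine heq _ (Γ.mul_mem hδ (Γ.inv_mem hγ)) fun x => ?_
    rw [map_mul, Equiv.Perm.mul_apply, ← hδx, hcf, hcongr γ hγ _ _ (hcf' _),
      ← Equiv.Perm.mul_apply, ← map_mul, mul_inv_cancel, map_one]
    rfl
  have hδ' : δ = γ := mul_inv_eq_one.1 hδγ
  have h1 : f (D.act γ p) = D.act γ p := by
    have := hδx p
    rwa [hδ', (Homeomorph.symm_apply_eq f).2 hp.symm] at this
  have h2 := hb (D.act γ p)
  rw [h1] at h2
  have h3 : (1 - b) * cayley (c' p) (c' (D.act γ p)) = 0 := by linear_combination h2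
  exact cayley_eq_zero_iff.1 ((mul_eq_zero.1 h3).resolve_left (sub_ne_zero.2 (Ne.symm hb1)))

/-- A lift that fixes two points and preserves the factors is the identity. -/
lemma eq_id_of_preserves_factors {σ : D.Surface Γ ≃ₜ D.Surface Γ}
    {f : (ℍ × ℍ) ≃ₜ (ℍ × ℍ)} (hf : ∀ x, D.proj Γ (f x) = σ (D.proj Γ x)) {p y : ℍ × ℍ}
    (hp : f p = p) (hy : f y = y) (hyp : y ≠ p) {a b : ℂ}
    (h : ∀ x, cayley p.1 (f x).1 = a * cayley p.1 x.1 ∧ cayley p.2 (f x).2 = b * cayley p.2 x.2)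
    (x : ℍ × ℍ) : f x = x := by
  have hab : a = 1 ∨ b = 1 := by
    have hne : y.1 ≠ p.1 ∨ y.2 ≠ p.2 := by
      by_contra! hc
      exact hyp (Prod.ext hc.1 hc.2)
    have hyy := h y
    rw [hy] at hyy
    refine hne.imp (fun hne => ?_) (fun hne => ?_)
    · exact (mul_eq_right₀ (cayley_eq_zero_iff.not.2 hne)).1 hyy.1.symm
    · exact (mul_eq_right₀ (cayley_eq_zero_iff.not.2 hne)).1 hyy.2.symm
  have hab' : a = 1 ∧ b = 1 := by
    rcases hab with rfl | rfl
    · refine ⟨rfl, hΓ.eq_one_of_lift_trivial_on_factor hA hf hp (c := Prod.fst) (c' := Prod.snd)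
        continuous_snd Prod.snd_surjective (fun γ _ x y => D.act_fst_congr γ)
        (fun γ hγ => hΓ.eq_one_of_fst hγ) (fun γ hγ x y => (hΓ.dist_act hγ x y).2)
        (fun x => cayley_injective p.1 (by rw [(h x).1, one_mul])) fun x => (h x).2⟩
    · refine ⟨hΓ.eq_one_of_lift_trivial_on_factor hA hf hp (c := Prod.snd) (c' := Prod.fst)
        continuous_fst Prod.fst_surjective (fun γ _ x y => D.act_snd_congr γ)
        (fun γ hγ => hΓ.eq_one_of_snd hγ) (fun γ hγ x y => (hΓ.dist_act hγ x y).1)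
        (fun x => cayley_injective p.2 (by rw [(h x).2, one_mul])) fun x => (h x).1, rfl⟩
  exact Prod.ext (cayley_injective p.1 (by rw [(h x).1, hab'.1, one_mul]))
    (cayley_injective p.2 (by rw [(h x).2, hab'.2, one_mul]))

/-- If there are infinitely many fixed points, then some lift has two fixed points. -/
lemma exists_lift_two_fixed {σ : D.Surface Γ ≃ₜ D.Surface Γ}
    (hinf : (Function.fixedPoints σ).Infinite) :
    ∃ (f : (ℍ × ℍ) ≃ₜ (ℍ × ℍ)) (p y : ℍ × ℍ), (∀ x, D.proj Γ (f x) = σ (D.proj Γ x)) ∧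
      f p = p ∧ f y = y ∧ y ≠ p := by
  have := hΓ.compactSpace hA
  have := hΓ.t2Space hA
  obtain ⟨x₀, hx₀⟩ := hinf.exists_accPt_principal
  have hcl : IsClosed (Function.fixedPoints σ) := isClosed_fixedPoints σ.continuous
  have hfix : σ x₀ = x₀ := isClosed_iff_clusterPt.1 hcl x₀ hx₀.clusterPt
  obtain ⟨p, rfl⟩ := D.proj_surjective x₀
  obtain ⟨f, hp, hf⟩ := hΓ.exists_lift hA σ hfix
  obtain ⟨V, hV, hpV, -, hVf⟩ := hΓ.exists_nhds_fixed_iff hA hf hp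
  obtain ⟨_, ⟨⟨y, hyV, rfl⟩, hyf⟩, hne⟩ := accPt_iff_nhds.1 hx₀ _
    ((hΓ.isOpenMap_proj hA V hV).mem_nhds ⟨p, hpV, rfl⟩)
  refine ⟨f, p, y, hf, hp, (hVf y hyV).1 hyf, ?_⟩
  rintro rfl
  exact hne rfl

/-- The fixed points of an automorphism with a factor-exchanging involutive lift form a divisor. -/
lemma isDivisor_fixedPoints {σ : D.Surface Γ ≃ₜ D.Surface Γ} (hσ : IsAutomorphism σ)
    {f : (ℍ × ℍ) ≃ₜ (ℍ × ℍ)} (hf : ∀ x, D.proj Γ (f x) = σ (D.proj Γ x)) {p : ℍ × ℍ} (hp : f p = p)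
    (hff : ∀ x, f (f x) = x) (h₁ : ∀ x y, x.2 = y.2 → (f x).1 = (f y).1)
    (h₂ : ∀ x y, x.1 = y.1 → (f x).2 = (f y).2) : IsDivisor (Function.fixedPoints σ) := by
  have := hΓ.t2Space hA
  have hcl : IsClosed (Function.fixedPoints σ) := isClosed_fixedPoints σ.continuous
  refine ⟨⟨D.proj Γ p, by rw [Function.mem_fixedPoints, Function.IsFixedPt, ← hf, hp]⟩, fun x => ?_⟩
  by_cases hx : x ∈ Function.fixedPoints σ
  swap
  · refine ⟨(Function.fixedPoints σ)ᶜ, fun _ => 1, hcl.isOpen_compl, hx, ?_, ?_, ?_⟩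
    · exact mdifferentiable_const.mdifferentiableOn
    · rintro V - - ⟨y, hy⟩
      exact ⟨y, hy, one_ne_zero⟩
    · ext y
      simp
  obtain ⟨q, rfl⟩ := D.proj_surjective x
  obtain ⟨f', hq, hf'⟩ := hΓ.exists_lift hA σ hx
  obtain ⟨V, hV, hqV, hinj, hVf⟩ := hΓ.exists_nhds_fixed_iff hA hf' hq
  -- The given lift $f$ need not fix $q$. The lift $f'=f\gamma$ does; it still exchanges the
  -- factors, and it is an involution because $f'^2$ lifts the identity and fixes $q$.
  obtain ⟨γ, hγ, hγf⟩ := hΓ.exists_deck hA (h := fun x => f.symm (f' x))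
    (f.symm.continuous.comp f'.continuous) (fun x => by
      apply σ.injective
      rw [← hf, Homeomorph.apply_symm_apply, hf'])
  have hf'γ : ∀ x, f' x = f (D.act γ x) := fun x => by
    rw [← hγf, Homeomorph.apply_symm_apply]
  have h₁' : ∀ x y, x.2 = y.2 → (f' x).1 = (f' y).1 := fun x y h => by
    rw [hf'γ, hf'γ]
    exact h₁ _ _ (D.act_snd_congr γ h)
  have h₂' : ∀ x y, x.1 = y.1 → (f' x).2 = (f' y).2 := fun x y h => by
    rw [hf'γ, hf'γ]
    exact h₂ _ _ (D.act_fst_congr γ h)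
  have hff' : ∀ x, f' (f' x) = x := fun x =>
    hΓ.eq_id_of_lift hA (h := fun x => f' (f' x)) (f'.continuous.comp f'.continuous)
      (fun x => by rw [hf', hf', ← hf, ← hf, hff]) (p := q) (by rw [hq, hq]) x
  -- For a factor-exchanging involution one coordinate equation implies the other, so a single
  -- function cuts out the fixed points.
  have hfix : ∀ x : ℍ × ℍ, f' x = x ↔ (f' x).1 = x.1 := by
    refine fun x => ⟨fun h => by rw [h], fun h => Prod.ext h ?_⟩
    rw [h₂' x (f' x) h.symm, hff']
  have hd := hΓ.mdifferentiable_lift hA hσ.1 f'.continuous hf'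
  have hc : MDifferentiable (𝓘(ℂ).prod 𝓘(ℂ)) 𝓘(ℂ) (fun x : ℍ × ℍ => (x.1 : ℂ) - ((f' x).1 : ℂ)) :=
    (mdifferentiable_coe.comp mdifferentiable_fst).sub
      (mdifferentiable_coe.comp (mdifferentiable_fst.comp hd))
  obtain ⟨g, hg, hgc⟩ := hΓ.exists_descent hV hinj hc
  have hgz : ∀ x ∈ V, g (D.proj Γ x) = 0 ↔ f' x = x := by
    intro x hx
    rw [hgc x hx, sub_eq_zero, hfix]
    exact ⟨fun h => (UpperHalfPlane.ext h).symm, fun h => by rw [h]⟩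
  refine ⟨D.proj Γ '' V, g, hΓ.isOpenMap_proj hA V hV, ⟨q, hqV, rfl⟩, hg, ?_, ?_⟩
  · rintro W hWV hW ⟨_, hyW⟩
    obtain ⟨y, hyV, rfl⟩ := hWV hyW
    by_contra! hzero
    have hopen : IsOpen (D.proj Γ ⁻¹' W ∩ V) := (hW.preimage (hΓ.continuous_proj hA)).inter hV
    -- On a slice $w=\text{const}$ the first coordinate of $f'$ is constant, so at most one point of
    -- the slice is fixed, while an open set contains several.
    have hev : ∀ᶠ z in 𝓝 y.1, (z, y.2) ∈ D.proj Γ ⁻¹' W ∩ V :=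
      (Continuous.prodMk_left y.2).continuousAt.eventually (hopen.mem_nhds ⟨hyW, hyV⟩)
    obtain ⟨z, hz, hzy⟩ := ((hev.filter_mono nhdsWithin_le_nhds).and
      (self_mem_nhdsWithin : ({y.1}ᶜ : Set ℍ) ∈ 𝓝[≠] y.1)).exists
    have e₁ := (hfix _).1 ((hgz y hyV).1 (hzero _ hyW))
    have e₂ := (hfix _).1 ((hgz _ hz.2).1 (hzero _ hz.1))
    exact hzy (e₂.symm.trans ((h₁' (z, y.2) y rfl).trans e₁))
  · ext y
    constructor
    · rintro ⟨hy, x, hx, rfl⟩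
      exact ⟨⟨x, hx, rfl⟩, (hgz x hx).2 ((hVf x hx).1 hy)⟩
    · rintro ⟨⟨x, hx, rfl⟩, hy⟩
      exact ⟨(hVf x hx).2 ((hgz x hx).1 hy), x, hx, rfl⟩

end TwoPlaceSplitting.IsSmoothShimuraGroup

/-- A factor-exchanging involution is conjugate to the exchange of the factors. -/
lemma liftsToConjugateOfSwap_of_lift {σ : D.Surface Γ ≃ₜ D.Surface Γ} {f : (ℍ × ℍ) ≃ₜ (ℍ × ℍ)}
    (hbi : IsBiholomorphicBidisc f) (hf : ∀ x, D.proj Γ (f x) = σ (D.proj Γ x))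
    (hff : ∀ x, f (f x) = x) (h₁ : ∀ x y, x.2 = y.2 → (f x).1 = (f y).1)
    (h₂ : ∀ x y, x.1 = y.1 → (f x).2 = (f y).2) : LiftsToConjugateOfSwap σ := by
  let u : ℍ → ℍ := fun w => (f (I, w)).1
  let v : ℍ → ℍ := fun z => (f (z, I)).2
  have hfuv : ∀ x, f x = (u x.2, v x.1) := fun x => Prod.ext (h₁ _ _ rfl) (h₂ _ _ rfl)
  have huv : ∀ z, u (v z) = z := fun z => by
    have := hff (z, I)
    rw [hfuv (z, I), hfuv] at this
    exact congrArg Prod.fst this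
  have hvu : ∀ w, v (u w) = w := fun w => by
    have := hff (I, w)
    rw [hfuv (I, w), hfuv] at this
    exact congrArg Prod.snd this
  have huc : Continuous u := by fun_prop
  have hvc : Continuous v := by fun_prop
  have hud : MDifferentiable 𝓘(ℂ) 𝓘(ℂ) u :=
    mdifferentiable_fst.comp (hbi.1.comp (mdifferentiable_const.prodMk mdifferentiable_id))
  have hvd : MDifferentiable 𝓘(ℂ) 𝓘(ℂ) v :=
    mdifferentiable_snd.comp (hbi.1.comp (mdifferentiable_id.prodMk mdifferentiable_const))
  -- Conjugating the exchange by $(z,w)\mapsto(u(z),w)$ gives $(z,w)\mapsto(u(w),v(z))$, with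
  -- $v=u^{-1}$.
  refine ⟨⟨⟨fun x => (u x.1, x.2), fun x => (v x.1, x.2), fun x => by simp [hvu],
    fun x => by simp [huv]⟩, by fun_prop, by fun_prop⟩, ⟨?_, ?_⟩, fun x => ?_⟩
  · exact (hud.comp mdifferentiable_fst).prodMk mdifferentiable_snd
  · exact (hvd.comp mdifferentiable_fst).prodMk mdifferentiable_snd
  · rw [← hf, hfuv]
    rfl

end FixedPoints

end Shimura

end

/-! ### The dichotomy for the fixed point set -/

theorem theorem1 {k : Type*} [Field k] [NumberField k] [NumberField.IsTotallyReal k]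
    {A : Type*} [DivisionRing A] [Algebra k A] [Algebra.IsCentral k A]
    (hA : Module.finrank k A = 4) (D : Shimura.TwoPlaceSplitting k A)
    (Γ : Subgroup (Shimura.ProjUnits k A)) (hΓ : D.IsSmoothShimuraGroup Γ)
    (σ : D.Surface Γ ≃ₜ D.Surface Γ) (hσ : Shimura.IsAutomorphism σ) (hσ1 : σ ≠ 1) :
    (Function.fixedPoints σ).Finite ∨
      ((Function.fixedPoints σ).Infinite ∧ Shimura.IsDivisor (Function.fixedPoints σ) ∧
        σ ^ 2 = 1 ∧ Shimura.LiftsToConjugateOfSwap σ) := by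
  refine (Set.finite_or_infinite _).imp_right fun hinf => ⟨hinf, ?_⟩
  obtain ⟨f, p, y, hf, hp, hy, hyp⟩ := hΓ.exists_lift_two_fixed hA hinf
  have hbi := hΓ.isBiholomorphic_lift hA hσ hf
  obtain ⟨a, b, h | h⟩ := hbi.cayley_linear p
  · rw [hp] at h
    refine absurd (Homeomorph.ext fun x => ?_) hσ1
    obtain ⟨x, rfl⟩ := D.proj_surjective x
    rw [← hf, hΓ.eq_id_of_preserves_factors hA hf hp hy hyp h]
    rfl
  · rw [hp] at h
    -- In Cayley coordinates the fixed point $y$ satisfies $y_1=ay_2$ and $y_2=by_1$, and one of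
    -- $y_1,y_2$ is nonzero.
    have hab : a * b = 1 := by
      have hyy := h y
      rw [hy] at hyy
      have hne : y.1 ≠ p.1 ∨ y.2 ≠ p.2 := by
        by_contra! hc
        exact hyp (Prod.ext hc.1 hc.2)
      rcases hne with hne | hne
      · refine (mul_eq_right₀ (Shimura.cayley_eq_zero_iff.not.2 hne)).1 ?_
        rw [mul_assoc, ← hyy.2, ← hyy.1]
      · refine (mul_eq_right₀ (Shimura.cayley_eq_zero_iff.not.2 hne)).1 ?_
        rw [mul_comm a b, mul_assoc, ← hyy.1, ← hyy.2]
    have hff : ∀ x, f (f x) = x := fun x =>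
      Prod.ext (Shimura.cayley_injective p.1 (by
          rw [(h (f x)).1, (h x).2, ← mul_assoc, hab, one_mul]))
        (Shimura.cayley_injective p.2 (by
          rw [(h (f x)).2, (h x).1, ← mul_assoc, mul_comm b a, hab, one_mul]))
    have h₁ : ∀ x y, x.2 = y.2 → (f x).1 = (f y).1 := fun x y hxy =>
      Shimura.cayley_injective p.1 (by rw [(h x).1, (h y).1, hxy])
    have h₂ : ∀ x y, x.1 = y.1 → (f x).2 = (f y).2 := fun x y hxy =>
      Shimura.cayley_injective p.2 (by rw [(h x).2, (h y).2, hxy])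
    refine ⟨hΓ.isDivisor_fixedPoints hA hσ hf hp hff h₁ h₂, Homeomorph.ext fun x => ?_,
      Shimura.liftsToConjugateOfSwap_of_lift hbi hf hff h₁ h₂⟩
    obtain ⟨x, rfl⟩ := D.proj_surjective x
    rw [pow_two]
    change σ (σ (D.proj Γ x)) = D.proj Γ x
    rw [← hf, ← hf, hff]
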